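/- **Setting.** There are $n$ buyers and $m$ items, with $k_j\ge k\ge 1$ units of each item $j$ (for instance $k=\min_j k_j$). Buyer $i$ has a private type $t_i\in T_i$, drawn independently from a known distribution $D_i$; let $D=D_1\times\dots\times D_n$. A (randomized) mechanism maps a reported type profile $t$ to random bundles $x_i\subseteq[m]$ and payments $p_i\ge 0$. Buyer $i$ is risk neutral with utility $v_i(t_i,x_i)-p_i$. The expected objective value of a mechanism is $\mathbf E_{t\sim D}\big[\sum_i \mathrm{Obj}_i(t_i,x_i,p_i)\big]$. For a mechanism $M$, let $M^{(i)}$ be the single-buyer mechanism that buyer $i$ perceives when the other buyers' types are drawn from their distributions; $M$ is Bayesian incentive compatible (BIC) if truthful reporting maximizes the expected utility of every type of every buyer $i$ in $M^{(i)}$. Let $\mathcal M$ be a space of BIC mechanisms satisfying the supply constraints ($\sum_i \mathbf 1[j\in x_i]\le k_j$ for every $j$, at every type profile with probability one), and let $\mathcal M_i=\{M^{(i)}: M\in\mathcal M\}$. Suppose $\mathcal M$ is convex (closed under randomizing between two of its members) and decomposable: every mechanism $M$ that satisfies the supply constraints and has $M^{(i)}\in\mathcal M_i$ for all $i$ lies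 in $\mathcal M$. **Single-buyer mechanisms.** For each $i$ and each $q\in[0,1]^m$ let $M_i(q)\in\mathcal M_i$ allocate each item $j$ with ex ante probability at most $q_j$ (over $t_i\sim D_i$ and the randomness of the mechanism), and let $R_i:[0,1]^m\to\mathbb R_{\ge0}$ be concave. Suppose that together they form an $\alpha$-approximation: for every $q$, the expected objective value of $M_i(q)$ is at least $\alpha R_i(q)$, and every mechanism in $\mathcal M_i$ that allocates each item $j$ with ex ante probability at most $q_j$ has expected objective value at most $R_i(q)$. **The $\gamma$-conservative magician.** It faces boxes $1,2,\dots$ with probabilities $x_1,x_2,\dots$ written on them. Let $F_1(w)=1$ for $w\ge0$, and $F_i(-1)=0$ for all $i$. Before box $i$ it sets $\theta_i=\min\{w\ge 0: F_i(w)\ge\gamma\}$; when $w$ wands have been broken so far, it opens box $i$ with probability $s_i^w$, where $s_i^w=1$ if $w<\theta_i$, $s_i^w=\frac{\gamma-F_i(w-1)}{F_i(w)-F_i(w-1)}$ if $w=\theta_i$, and $s_i^w=0$ if $w>\theta_i$. Then $F_{i+1}(w)=s_i^wx_iF_i(w-1)+(1-s_i^wx_i)F_i(w)$. Let $\gamma_k$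 be the largest $\gamma\in[0,1]$ such that, for every integer $K\ge k$ and every finite sequence $x_1,\dots,x_N\in[0,1]$ with $\sum_i x_i\le K$, all thresholds $\theta_1,\dots,\theta_N$ are less than $K$. **$\gamma$-post-rounding.** Let $(q_{ij})$ maximize $\sum_i R_i(q_i)$ subject to $\sum_i q_{ij}\le k_j$ for all $j$ and $q_{ij}\in[0,1]$. Run $M_i(q_i)$ simultaneously and independently for all buyers $i$, with tentative outcomes $(x_i',p_i')$. For each item $j$ create a $\gamma$-conservative magician. For $i=1,\dots,n$: present to each magician $j$ a box with the exact ex ante probability $\hat q_{ij}$ that $M_i(q_i)$ allocates item $j$ written on it; let $S_i$ be the set of items whose magicians open the box; give buyer $i$ the bundle $x_i=S_i\cap x_i'$ at payment $p_i=\gamma p_i'$; break a wand of magician $j$ for each $j\in x_i$. **Assumptions.** 1. $\mathrm{Obj}_i(t,S,p)=\mathrm{Obj}_i(t,S,0)+c_i\,p$ with a constant $c_i\ge0$, and for every $t$ the function $S\mapsto \mathrm{Obj}_i(t,S,0)$ has a budget balanced cross monotonic cost sharing scheme, i.e. there is $\xi(j,S)\ge 0$ with $\sum_{j\in S}\xi(j,S)=\mathrm{Obj}_i(t,S,0)$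 and $\xi(j,S\cup S')\le\xi(j,S)$ for all $j,S,S'$. 2. The single-buyer constraints defining $\mathcal M$ do not rule out post-rounding for a reason other than incentives: for each buyer $i$, if the single-buyer mechanism that buyer $i$ perceives in $\gamma$-post-rounding is incentive compatible, then it lies in $\mathcal M_i$. 3. For every type $t$ of buyer $i$, $v_i(t,\cdot)$ is the weighted rank function of a matroid on the items with nonnegative weights ($v_i(t,S)$ is the maximum weight of an independent subset of $S$). The bundles allocated by $M_i(q_i)$, under any report, are independent in the matroid of every type of buyer $i$ (if buyer $i$ has a single, publicly known matroid, this says that they are independent in it). **Theorem ($\gamma$-Post-Rounding).** For every $\gamma\in[0,\gamma_k]$, the $\gamma$-post-rounding mechanism is Bayesian incentive compatible, belongs to $\mathcal M$, and is a $\gamma\alpha$-approximation of the optimal mechanism in $\mathcal M$: its expected objective value is at least $\gamma\alpha$ times that of every mechanism in $\mathcal M$. -/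

import Mathlib

open MeasureTheory ProbabilityTheory
open scoped NNReal ENNReal

/-! ### Mechanisms -/

section Model

/-- The outcome for one buyer: the set of items she receives (at most one unit of each item) and
her payment. -/
abbrev Outcome (m : ℕ) : Type := Finset (Fin m) × ℝ≥0

/-- A randomized direct mechanism with reports in `Θ` and outcomes in `Ω`: to each report it assigns
a probability distribution over outcomes, measurably in the report. -/
structure Mechanism (Θ Ω : Type*) [MeasurableSpace Θ] [MeasurableSpace Ω] where
  kernel : Kernel Θ Ω
  isMarkov : IsMarkovKernel kernel

attribute [instance] Mechanism.isMarkov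

/-- A mechanism for one buyer with type space `Θ`. -/
abbrev SingleMechanism (Θ : Type*) [MeasurableSpace Θ] (m : ℕ) : Type _ :=
  Mechanism Θ (Outcome m)

/-- A mechanism for `n` buyers, buyer `i` having type space `T i`. -/
abbrev MultiMechanism {n : ℕ} (T : Fin n → Type*) [∀ i, MeasurableSpace (T i)] (m : ℕ) : Type _ :=
  Mechanism (∀ i, T i) (Fin n → Outcome m)

/-! ### Single buyer notions -/

/-- Incentive compatibility of a single buyer mechanism for a risk neutral buyer with quasilinear
utility `v t S - p`: for every true type `t` and every report `t'`,
`E[v t (x t')] - E[p t'] ≤ E[v t (x t)] - E[p t]`. The payments, which are nonnegative, are moved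
to the other side, so that no expectation has to be assumed finite. -/
def IsIC {Θ : Type*} [MeasurableSpace Θ] {m : ℕ} (v : Θ → Finset (Fin m) → ℝ≥0)
    (N : SingleMechanism Θ m) : Prop :=
  ∀ t t' : Θ,
    (∫⁻ o, (v t o.1 : ℝ≥0∞) ∂(N.kernel t')) + ∫⁻ o, (o.2 : ℝ≥0∞) ∂(N.kernel t) ≤
      (∫⁻ o, (v t o.1 : ℝ≥0∞) ∂(N.kernel t)) + ∫⁻ o, (o.2 : ℝ≥0∞) ∂(N.kernel t')

/-- The exact ex ante allocation rule: the probability that item `j` is allocated, over the type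
`t ∼ D` and the randomness of the mechanism. -/
noncomputable def exAnte {Θ : Type*} [MeasurableSpace Θ] {m : ℕ} (D : Measure Θ)
    (N : SingleMechanism Θ m) (j : Fin m) : ℝ :=
  (∫⁻ t, N.kernel t {o | j ∈ o.1} ∂D).toReal

/-- The expected objective value of a single buyer mechanism. Objectives take nonnegative values, as
they do whenever they are of the form `f t S + c * p` with `c ≥ 0` and `f` has nonnegative cost
shares; so the expectation always makes sense in `[0,∞]`. -/
noncomputable def singleObjective {Θ : Type*} [MeasurableSpace Θ] {m : ℕ} (D : Measure Θ)
    (obj : Θ → Finset (Fin m) → ℝ≥0 → ℝ≥0) (N : SingleMechanism Θ m) : ℝ≥0∞ :=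
  ∫⁻ t, ∫⁻ o, (obj t o.1 o.2 : ℝ≥0∞) ∂(N.kernel t) ∂D

/-- The single buyer mechanisms `mech q`, where `q` ranges over the upper bounds in `[0,1]^m` on the
ex ante allocation rule, together with the concave benchmark `R`, provide an `α`-approximation of
the optimal single buyer mechanism / optimal benchmark over the space `S` of feasible single buyer
mechanisms. -/
structure IsApproxSingle {Θ : Type*} [MeasurableSpace Θ] {m : ℕ} (α : ℝ≥0) (D : Measure Θ)
    (obj : Θ → Finset (Fin m) → ℝ≥0 → ℝ≥0) (S : Set (SingleMechanism Θ m))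
    (mech : (Fin m → ℝ) → SingleMechanism Θ m) (R : (Fin m → ℝ) → ℝ≥0) : Prop where
  concave : ConcaveOn ℝ (Set.Icc 0 1) (fun q => (R q : ℝ))
  feasible : ∀ q ∈ Set.Icc (0 : Fin m → ℝ) 1, mech q ∈ S
  exAnte_le : ∀ q ∈ Set.Icc (0 : Fin m → ℝ) 1, ∀ j, exAnte D (mech q) j ≤ q j
  approx : ∀ q ∈ Set.Icc (0 : Fin m → ℝ) 1,
    ((α * R q : ℝ≥0) : ℝ≥0∞) ≤ singleObjective D obj (mech q)
  upperBound : ∀ q ∈ Set.Icc (0 : Fin m → ℝ) 1, ∀ N ∈ S, (∀ j, exAnte D N j ≤ q j) →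
    singleObjective D obj N ≤ (R q : ℝ≥0∞)

/-! ### Multi buyer notions -/

/-- The single buyer mechanism that buyer `i` perceives when the other buyers are simulated: on
report `t`, draw a type profile from the prior, replace its `i`-th entry by `t`, run the mechanism,
and keep the outcome of buyer `i`. -/
noncomputable def induced {n m : ℕ} {T : Fin n → Type*} [∀ i, MeasurableSpace (T i)]
    (D : ∀ i, Measure (T i)) [∀ i, IsProbabilityMeasure (D i)] (i : Fin n)
    (M : MultiMechanism T m) : SingleMechanism (T i) m where
  kernel :=
    ((M.kernel.comap (fun p : T i × (∀ l, T l) => Function.update p.2 i p.1) (by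
        refine measurable_pi_lambda _ fun l => ?_
        by_cases h : l = i
        · subst h
          simpa using measurable_fst
        · simp only [Function.update_of_ne h]
          fun_prop)) ∘ₖ
      (Kernel.id ×ₖ Kernel.const (T i) (Measure.pi D))).map (fun o => o i)
  isMarkov := Kernel.IsMarkovKernel.map _ (measurable_pi_apply i)

/-- Bayesian incentive compatibility: for every buyer, in expectation over the types of the other
buyers, truthful reporting is optimal. -/
def IsBIC {n m : ℕ} {T : Fin n → Type*} [∀ i, MeasurableSpace (T i)]
    (D : ∀ i, Measure (T i)) [∀ i, IsProbabilityMeasure (D i)]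
    (v : ∀ i, T i → Finset (Fin m) → ℝ≥0) (M : MultiMechanism T m) : Prop :=
  ∀ i, IsIC (v i) (induced D i M)

/-- The supply constraints: at every type profile, with probability one, at most `units j` units of
each item `j` are allocated. -/
def MeetsSupply {n m : ℕ} {T : Fin n → Type*} [∀ i, MeasurableSpace (T i)]
    (units : Fin m → ℕ) (M : MultiMechanism T m) : Prop :=
  ∀ t, ∀ᵐ o ∂(M.kernel t), ∀ j, (Finset.univ.filter fun i => j ∈ (o i).1).card ≤ units j

/-- The space of feasible single buyer mechanisms for buyer `i`. -/
def singleSpace {n m : ℕ} {T : Fin n → Type*} [∀ i, MeasurableSpace (T i)]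
    (D : ∀ i, Measure (T i)) [∀ i, IsProbabilityMeasure (D i)] (C : Set (MultiMechanism T m))
    (i : Fin n) : Set (SingleMechanism (T i) m) :=
  induced D i '' C

/-- The standing assumptions on the space `C` of feasible mechanisms: its members respect the supply
and are Bayesian incentive compatible, it is convex, and it is decomposable into supply constraints
and single buyer constraints. -/
structure IsMechanismSpace {n m : ℕ} {T : Fin n → Type*} [∀ i, MeasurableSpace (T i)]
    (D : ∀ i, Measure (T i)) [∀ i, IsProbabilityMeasure (D i)] (units : Fin m → ℕ)
    (v : ∀ i, T i → Finset (Fin m) → ℝ≥0) (C : Set (MultiMechanism T m)) : Prop where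
  supply : ∀ M ∈ C, MeetsSupply units M
  bic : ∀ M ∈ C, IsBIC D v M
  convex : ∀ M ∈ C, ∀ M' ∈ C, ∀ β : ℝ≥0, β ≤ 1 → ∀ M'' : MultiMechanism T m,
    (∀ t, M''.kernel t = β • M.kernel t + (1 - β) • M'.kernel t) → M'' ∈ C
  decomposable : ∀ M : MultiMechanism T m, MeetsSupply units M →
    (∀ i, induced D i M ∈ singleSpace D C i) → M ∈ C

/-- The expected value of the linearly separable objective `∑ i, obj i`, over independent types. -/
noncomputable def expectedObjective {n m : ℕ} {T : Fin n → Type*} [∀ i, MeasurableSpace (T i)]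
    (D : ∀ i, Measure (T i)) (obj : ∀ i, T i → Finset (Fin m) → ℝ≥0 → ℝ≥0)
    (M : MultiMechanism T m) : ℝ≥0∞ :=
  ∫⁻ t, ∫⁻ o, ((∑ i, obj i (t i) (o i).1 (o i).2 : ℝ≥0) : ℝ≥0∞) ∂(M.kernel t) ∂(Measure.pi D)

/-- `q` is an optimal assignment of the benchmark program: maximize `∑ i, R i (q i)` subject to
`q i j ∈ [0,1]` and `∑ i, q i j ≤ units j` for each item `j`. -/
def IsOptimalAssignment {n m : ℕ} (units : Fin m → ℕ) (R : Fin n → (Fin m → ℝ) → ℝ≥0)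
    (q : Fin n → Fin m → ℝ) : Prop :=
  let F : Set (Fin n → Fin m → ℝ) :=
    {y | (∀ i, y i ∈ Set.Icc 0 1) ∧ ∀ j, ∑ i, y i j ≤ units j}
  q ∈ F ∧ ∀ y ∈ F, ∑ i, R i (y i) ≤ ∑ i, R i (q i)

end Model

/-! ### Assumptions on objectives and valuations -/

section Assumptions

/-- `f` has a budget balanced cross monotonic cost sharing scheme `ξ`. -/
def HasCostSharing {m : ℕ} (f : Finset (Fin m) → ℝ≥0) : Prop :=
  ∃ ξ : Fin m → Finset (Fin m) → ℝ≥0,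
    (∀ S, ∑ j ∈ S, ξ j S = f S) ∧ ∀ j S S', ξ j (S ∪ S') ≤ ξ j S

/-- `v` is the weighted rank function of the matroid `N` on all items with weights `w`: `v S` is the
weight of a maximum weight independent subset of `S`. -/
def IsWeightedRank {m : ℕ} (N : Matroid (Fin m)) (w : Fin m → ℝ≥0)
    (v : Finset (Fin m) → ℝ≥0) : Prop :=
  N.E = Set.univ ∧
    ∀ S, IsGreatest {a | ∃ B : Finset (Fin m), B ⊆ S ∧ N.Indep (B : Set (Fin m)) ∧ ∑ j ∈ B, w j = a} (v S)

end Assumptions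

/-! ### The conservative magician

Boxes are numbered from `0`, and `x i` is the probability written on box `i`. Cumulative
distribution functions of numbers of broken wands are functions `F : ℕ → ℝ`, with `F (-1) = 0`. -/

section Magician

/-- `F (w - 1)`, which is `0` for `w = 0`. -/
def cdfPred (F : ℕ → ℝ) : ℕ → ℝ
  | 0 => 0
  | w + 1 => F w

/-- The smallest `w` with `F w ≥ γ`. -/
noncomputable def threshold (γ : ℝ) (F : ℕ → ℝ) : ℕ := sInf {w | γ ≤ F w}

/-- The probability of opening the current box when `w` wands are broken, where `F` is the
distribution function of the number of wands broken so far. -/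
noncomputable def openProb (γ : ℝ) (F : ℕ → ℝ) (w : ℕ) : ℝ :=
  if w < threshold γ F then 1
  else if w = threshold γ F then (γ - cdfPred F w) / (F w - cdfPred F w)
  else 0

/-- The distribution function of the number of wands broken before box `i` is seen. -/
noncomputable def brokenCDF (γ : ℝ) (x : ℕ → ℝ) : ℕ → ℕ → ℝ
  | 0, _ => 1
  | i + 1, w =>
    openProb γ (brokenCDF γ x i) w * x i * cdfPred (brokenCDF γ x i) w +
      (1 - openProb γ (brokenCDF γ x i) w * x i) * brokenCDF γ x i w

/-- The parameter `γ_k`: the largest `γ ∈ [0,1]` such that for every `K ≥ k` and every instance with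
`K` wands (a finite sequence of boxes whose written probabilities sum to at most `K`), all thresholds
of the `γ`-conservative magician are less than `K`. -/
noncomputable def magicianParam (k : ℕ) : ℝ :=
  sSup {γ : ℝ | γ ∈ Set.Icc 0 1 ∧ ∀ K : ℕ, k ≤ K → ∀ (N : ℕ) (x : ℕ → ℝ),
    (∀ i, x i ∈ Set.Icc 0 1) → ∑ i ∈ Finset.range N, x i ≤ K →
      ∀ i < N, threshold γ (brokenCDF γ x i) < K}

/-- Extension of a finite sequence of written probabilities by `0`. -/
def extendBoxes {n : ℕ} (x : Fin n → ℝ) (i : ℕ) : ℝ := if h : i < n then x ⟨i, h⟩ else 0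

/-- The number of wands broken before box `i` is seen, in a run of the `γ`-conservative magician on
boxes with written probabilities `x`. The coin of a box, uniform in `[0,1]`, decides whether the
box is opened: this is so if the coin is below the opening probability. The wand used on an opened
box `i` breaks iff `brk i` holds. -/
noncomputable def brokenWands {n : ℕ} (γ : ℝ) (x : Fin n → ℝ) (coin : Fin n → unitInterval)
    (brk : Fin n → Prop) : ℕ → ℕ
  | 0 => 0
  | i + 1 =>
    open Classical in
    brokenWands γ x coin brk i +
      if ∃ h : i < n, (coin ⟨i, h⟩ : ℝ) < openProb γ (brokenCDF γ (extendBoxes x) i)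
          (brokenWands γ x coin brk i) ∧ brk ⟨i, h⟩ then 1 else 0

/-- The magician opens box `i` in this run. -/
def opensBox {n : ℕ} (γ : ℝ) (x : Fin n → ℝ) (coin : Fin n → unitInterval)
    (brk : Fin n → Prop) (i : Fin n) : Prop :=
  (coin i : ℝ) < openProb γ (brokenCDF γ (extendBoxes x) i) (brokenWands γ x coin brk i)

end Magician

/-! ### Post-rounding -/

section PostRounding

/-- Running single buyer mechanisms simultaneously and independently. -/
noncomputable def runAll {n m : ℕ} {T : Fin n → Type*} [∀ i, MeasurableSpace (T i)]
    (N : ∀ i, SingleMechanism (T i) m) : MultiMechanism T m where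
  kernel :=
    { toFun := fun t => Measure.pi fun i => (N i).kernel (t i)
      measurable' := by
        refine Measurable.measure_of_isPiSystem_of_isProbabilityMeasure
          generateFrom_pi.symm isPiSystem_pi ?_
        rintro _ ⟨s, hs, rfl⟩
        simp only [Measure.pi_pi]
        exact Finset.measurable_fun_prod _ fun i _ =>
          ((N i).kernel.measurable_coe (hs i (Set.mem_univ i))).comp (measurable_pi_apply i) }
  isMarkov := ⟨fun t => by
    change IsProbabilityMeasure (Measure.pi fun i => (N i).kernel (t i))
    infer_instance⟩

/-- Deallocation. Given the tentative outcomes `ω.1` of the buyers and the coins `ω.2` of the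
magicians, where magician `j` sees one box per buyer, with `x i j` written on the box of buyer `i`,
buyer `i` keeps those of her items `j` for which magician `j` opens her box, and pays `γ` times
her tentative payment. A wand of magician `j` breaks whenever a unit of item `j` is allocated. -/
noncomputable def deallocate {n m : ℕ} (γ : ℝ) (x : Fin n → Fin m → ℝ)
    (ω : (Fin n → Outcome m) × (Fin n → Fin m → unitInterval)) (i : Fin n) : Outcome m :=
  open Classical in
  ((ω.1 i).1.filter fun j =>
      opensBox γ (fun l => x l j) (fun l => ω.2 l j) (fun l => j ∈ (ω.1 l).1) i,
    Real.toNNReal γ * (ω.1 i).2)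

theorem measurable_brokenWands {n m : ℕ} (γ : ℝ) (x : Fin n → Fin m → ℝ) (j : Fin m) (i : ℕ) :
    Measurable fun ω : (Fin n → Outcome m) × (Fin n → Fin m → unitInterval) =>
      brokenWands γ (fun l => x l j) (fun l => ω.2 l j) (fun l => j ∈ (ω.1 l).1) i := by
  classical
  induction i with
  | zero => exact measurable_const
  | succ i ih =>
    simp only [brokenWands]
    refine ih.add (Measurable.ite ?_ measurable_const measurable_const)
    by_cases h : i < n
    · simp only [h, exists_true_left]
      refine measurableSet_setOfPred.2 (Measurable.and ?_ ?_)
      · exact measurableSet_setOfPred.1 (measurableSet_lt (by fun_prop)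
          ((measurable_from_nat (f := openProb γ _)).comp ih))
      · exact (measurable_finset_mem j).comp (by fun_prop)
    · simp [h]

theorem measurable_deallocate {n m : ℕ} (γ : ℝ) (x : Fin n → Fin m → ℝ) :
    Measurable (deallocate (n := n) (m := m) γ x) := by
  classical
  refine measurable_pi_lambda _ fun i => Measurable.prodMk ?_ ?_
  · refine measurable_finset_iff.2 fun j => ?_
    simp only [Finset.mem_filter]
    refine Measurable.and ((measurable_finset_mem j).comp (by fun_prop)) ?_
    refine measurableSet_setOfPred.1 (measurableSet_lt (by fun_prop) ?_)
    exact (measurable_from_nat (f := openProb γ _)).comp (measurable_brokenWands γ x j i)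
  · fun_prop

/-- The `γ`-post-rounding of single buyer mechanisms `N i`: run them simultaneously and
independently, and deallocate by one `γ`-conservative magician per item, the probability written on
the box of buyer `i` for item `j` being the exact probability that `N i` allocates item `j`. -/
noncomputable def postRounding {n m : ℕ} {T : Fin n → Type*} [∀ i, MeasurableSpace (T i)]
    (D : ∀ i, Measure (T i)) (γ : ℝ) (N : ∀ i, SingleMechanism (T i) m) :
    MultiMechanism T m where
  kernel :=
    ((runAll N).kernel ×ₖ Kernel.const _ (volume : Measure (Fin n → Fin m → unitInterval))).map
      (deallocate γ fun i j => exAnte (D i) (N i) j)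
  isMarkov := Kernel.IsMarkovKernel.map _ (measurable_deallocate γ _)

end PostRounding

/-! The magician's opening probabilities are tuned so that, averaged over the number of wands broken
so far, a box is opened with probability exactly γ (`sum_openProb_brokenCDF`). That number depends
only on earlier buyers, hence is independent of buyer i's tentative outcome. So each item of her
tentative bundle survives with probability γ whatever she reports, even though her own report may
make the probability on her box wrong (`lintegral_opensBox`). Different magicians may be correlated,
but every quantity below is, or is bounded by, a sum over items, and linearity of expectation
suffices (`lintegral_sum_deallocate`).

Incentives: a weighted rank function is additive on independent sets, and these are closed under
deletion. Hence every expected value scales by γ, as the payments do by design, and so does each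
incentive inequality.

Supply: units of item j allocated are wands broken by magician j. A box is opened only while the
count is at most the threshold, and for γ ≤ γ_k all thresholds are below the supply, so the bound
holds in every run.

Objective: cross monotonicity lets each surviving item keep at least its old cost share, so a γ
fraction is retained. The ex ante rule of any mechanism in the space is feasible for the benchmark
program, whose optimum therefore bounds its objective. -/

/-! ### Distribution functions of the conservative magician -/

theorem cdfPred_le {F : ℕ → ℝ} (h0 : ∀ w, 0 ≤ F w) (hF : Monotone F) (w : ℕ) :
    cdfPred F w ≤ F w := by
  cases w with
  | zero => exact h0 0
  | succ w => exact hF w.le_succ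

theorem cdfPred_nonneg {F : ℕ → ℝ} (h0 : ∀ w, 0 ≤ F w) (w : ℕ) : 0 ≤ cdfPred F w := by
  cases w with
  | zero => exact le_rfl
  | succ w => exact h0 w

theorem threshold_le_iff {γ : ℝ} {F : ℕ → ℝ} (hF : Monotone F) (hne : ∃ w, γ ≤ F w) (w : ℕ) :
    threshold γ F ≤ w ↔ γ ≤ F w :=
  ⟨fun h => (Nat.sInf_mem (s := {w | γ ≤ F w}) hne).trans (hF h),
    fun h => Nat.sInf_le (s := {w | γ ≤ F w}) h⟩

theorem cdfPred_lt_of_le_threshold {γ : ℝ} {F : ℕ → ℝ} (hF : Monotone F) (hne : ∃ w, γ ≤ F w)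
    {w : ℕ} (hw : w ≤ threshold γ F) (h0 : w ≠ 0) : cdfPred F w < γ := by
  obtain ⟨w, rfl⟩ := Nat.exists_eq_succ_of_ne_zero h0
  by_contra! h
  have := (threshold_le_iff hF hne w).2 h
  omega

/-- The atom of F at w occupies the interval from F(w-1) to F(w), and the magician opens on the part
of it below γ. This form has no threshold in it, so sums telescope and dependence on γ is
continuous. -/
theorem openProb_mul_sub {γ : ℝ} {F : ℕ → ℝ} (hγ : 0 ≤ γ) (hF : Monotone F)
    (hne : ∃ w, γ ≤ F w) (w : ℕ) :
    openProb γ F w * (F w - cdfPred F w) = min γ (F w) - min γ (cdfPred F w) := by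
  have hlt : ∀ w, w ≤ threshold γ F → cdfPred F w ≤ γ := by
    intro w hw
    rcases eq_or_ne w 0 with rfl | h
    · exact hγ
    · exact (cdfPred_lt_of_le_threshold hF hne hw h).le
  unfold openProb
  split_ifs with h1 h2
  · have h3 : F w < γ := by
      by_contra! h
      exact absurd ((threshold_le_iff hF hne w).2 h) (by omega)
    rw [min_eq_right h3.le, min_eq_right (hlt w h1.le), one_mul]
  · have h3 : γ ≤ F w := (threshold_le_iff hF hne w).1 h2.ge
    rw [min_eq_left h3, min_eq_right (hlt w h2.le)]
    -- If the atom is empty, the quotient has denominator zero, but then F(w) = γ and the right side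
    -- vanishes too.
    rcases eq_or_ne (F w) (cdfPred F w) with h | h
    · have := hlt w h2.le
      rw [← h] at this ⊢
      simp [le_antisymm this h3]
    · exact div_mul_cancel₀ _ (sub_ne_zero.2 h)
  · obtain ⟨w, rfl⟩ := Nat.exists_eq_succ_of_ne_zero (by omega : w ≠ 0)
    have h3 : γ ≤ F w := (threshold_le_iff hF hne w).1 (by omega)
    rw [min_eq_left (h3.trans (hF w.le_succ)), cdfPred, min_eq_left h3]
    simp

theorem openProb_mem_Icc {γ : ℝ} {F : ℕ → ℝ} (hγ : 0 ≤ γ) (hF : Monotone F)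
    (hne : ∃ w, γ ≤ F w) (w : ℕ) : openProb γ F w ∈ Set.Icc (0 : ℝ) 1 := by
  unfold openProb
  split_ifs with h1 h2
  · simp
  · have h3 : γ ≤ F w := (threshold_le_iff hF hne w).1 h2.ge
    have h4 : cdfPred F w ≤ γ := by
      rcases eq_or_ne w 0 with rfl | h
      · exact hγ
      · exact (cdfPred_lt_of_le_threshold hF hne h2.le h).le
    exact ⟨div_nonneg (by linarith) (by linarith),
      div_le_one_of_le₀ (by linarith) (by linarith)⟩
  · simp

/-- One step of the recursion is nondecreasing in a because min γ is 1-Lipschitz and x ≤ 1,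
nondecreasing in b, and nonincreasing in γ when b ≤ a. It yields nonnegativity, monotonicity in the
number of wands, and monotonicity in γ. -/
theorem sub_mul_min_sub_min_le {γ γ' x a a' b b' : ℝ} (hx : x ∈ Set.Icc (0 : ℝ) 1) (hγ : γ' ≤ γ)
    (ha : a ≤ a') (hb : b ≤ b') (hab : b ≤ a) :
    a - x * (min γ a - min γ b) ≤ a' - x * (min γ' a' - min γ' b') := by
  have h1 : min γ' a - min γ' b ≤ min γ a - min γ b := by
    rcases le_total γ' a with h | h <;> rcases le_total γ' b with h' | h' <;>
    rcases le_total γ a with h'' | h'' <;> rcases le_total γ b with h''' | h''' <;>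
    simp only [min_eq_left, min_eq_right, *] <;> linarith
  have h2 : min γ' a' ≤ min γ' a + (a' - a) := by
    rcases le_total γ' a with h | h
    · rw [min_eq_left h]; linarith [min_le_left γ' a']
    · rw [min_eq_right h]; linarith [min_le_right γ' a']
  have h3 : min γ' b ≤ min γ' b' := min_le_min_left _ hb
  have h4 : x * (min γ' a' - min γ' b') ≤ x * (min γ a - min γ b + (a' - a)) :=
    mul_le_mul_of_nonneg_left (by linarith) hx.1
  have h5 : x * (a' - a) ≤ a' - a := mul_le_of_le_one_left (by linarith) hx.2
  linarith

section

variable {γ : ℝ} {x : ℕ → ℝ}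

/-- Basic properties of the distribution functions of the numbers of broken wands. -/
theorem brokenCDF_basic (hγ : γ ∈ Set.Icc (0 : ℝ) 1) (hx : ∀ i, x i ∈ Set.Icc (0 : ℝ) 1) (i : ℕ) :
    (∀ w, 0 ≤ brokenCDF γ x i w) ∧ Monotone (brokenCDF γ x i) ∧
      (∀ w, i ≤ w → brokenCDF γ x i w = 1) ∧
      ∀ w, brokenCDF γ x (i + 1) w = brokenCDF γ x i w -
        x i * (min γ (brokenCDF γ x i w) - min γ (cdfPred (brokenCDF γ x i) w)) := by
  have key : ∀ i, (∀ w, 0 ≤ brokenCDF γ x i w) → Monotone (brokenCDF γ x i) →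
      (∀ w, i ≤ w → brokenCDF γ x i w = 1) →
      ∀ w, brokenCDF γ x (i + 1) w = brokenCDF γ x i w -
        x i * (min γ (brokenCDF γ x i w) - min γ (cdfPred (brokenCDF γ x i) w)) := by
    intro i h0 hF h1 w
    rw [← openProb_mul_sub hγ.1 hF ⟨i, by rw [h1 i le_rfl]; exact hγ.2⟩, brokenCDF]
    ring
  induction i with
  | zero =>
    have h0 : ∀ w, 0 ≤ brokenCDF γ x 0 w := fun w => zero_le_one
    have hF : Monotone (brokenCDF γ x 0) := fun _ _ _ => le_rfl
    have h1 : ∀ w, 0 ≤ w → brokenCDF γ x 0 w = 1 := fun _ _ => rfl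
    exact ⟨h0, hF, h1, key 0 h0 hF h1⟩
  | succ i ih =>
    obtain ⟨h0, hF, h1, hs⟩ := ih
    have h0' : ∀ w, 0 ≤ brokenCDF γ x (i + 1) w := by
      intro w
      rw [hs]
      -- Compare with a = b = 0.
      have := sub_mul_min_sub_min_le (hx i) le_rfl (h0 w) (cdfPred_nonneg h0 w)
        (γ := γ) le_rfl
      simpa using this
    have hF' : Monotone (brokenCDF γ x (i + 1)) := by
      refine monotone_nat_of_le_succ fun w => ?_
      rw [hs, hs]
      exact sub_mul_min_sub_min_le (hx i) le_rfl (hF w.le_succ) (cdfPred_le h0 hF w)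
        (cdfPred_le h0 hF w)
    have h1' : ∀ w, i + 1 ≤ w → brokenCDF γ x (i + 1) w = 1 := by
      intro w hw
      obtain ⟨w, rfl⟩ := Nat.exists_eq_succ_of_ne_zero (by omega : w ≠ 0)
      rw [hs, cdfPred, h1 w (by omega), h1 _ (by omega)]
      simp
    exact ⟨h0', hF', h1', key (i + 1) h0' hF' h1'⟩

theorem brokenCDF_nonneg (hγ : γ ∈ Set.Icc (0 : ℝ) 1) (hx : ∀ i, x i ∈ Set.Icc (0 : ℝ) 1)
    (i w : ℕ) : 0 ≤ brokenCDF γ x i w := (brokenCDF_basic hγ hx i).1 w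

theorem brokenCDF_mono (hγ : γ ∈ Set.Icc (0 : ℝ) 1) (hx : ∀ i, x i ∈ Set.Icc (0 : ℝ) 1)
    (i : ℕ) : Monotone (brokenCDF γ x i) := (brokenCDF_basic hγ hx i).2.1

theorem brokenCDF_eq_one (hγ : γ ∈ Set.Icc (0 : ℝ) 1) (hx : ∀ i, x i ∈ Set.Icc (0 : ℝ) 1)
    {i w : ℕ} (h : i ≤ w) : brokenCDF γ x i w = 1 := (brokenCDF_basic hγ hx i).2.2.1 w h

theorem brokenCDF_succ (hγ : γ ∈ Set.Icc (0 : ℝ) 1) (hx : ∀ i, x i ∈ Set.Icc (0 : ℝ) 1)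
    (i w : ℕ) : brokenCDF γ x (i + 1) w = brokenCDF γ x i w -
        x i * (min γ (brokenCDF γ x i w) - min γ (cdfPred (brokenCDF γ x i) w)) :=
  (brokenCDF_basic hγ hx i).2.2.2 w

theorem exists_le_brokenCDF (hγ : γ ∈ Set.Icc (0 : ℝ) 1) (hx : ∀ i, x i ∈ Set.Icc (0 : ℝ) 1)
    (i : ℕ) : ∃ w, γ ≤ brokenCDF γ x i w :=
  ⟨i, by rw [brokenCDF_eq_one hγ hx le_rfl]; exact hγ.2⟩

theorem openProb_brokenCDF_mem_Icc (hγ : γ ∈ Set.Icc (0 : ℝ) 1)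
    (hx : ∀ i, x i ∈ Set.Icc (0 : ℝ) 1) (i w : ℕ) :
    openProb γ (brokenCDF γ x i) w ∈ Set.Icc (0 : ℝ) 1 :=
  openProb_mem_Icc hγ.1 (brokenCDF_mono hγ hx i)
    (exists_le_brokenCDF hγ hx i) w

theorem openProb_brokenCDF_mul_sub (hγ : γ ∈ Set.Icc (0 : ℝ) 1)
    (hx : ∀ i, x i ∈ Set.Icc (0 : ℝ) 1) (i w : ℕ) :
    openProb γ (brokenCDF γ x i) w * (brokenCDF γ x i w - cdfPred (brokenCDF γ x i) w) =
      min γ (brokenCDF γ x i w) - min γ (cdfPred (brokenCDF γ x i) w) :=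
  openProb_mul_sub hγ.1 (brokenCDF_mono hγ hx i)
    (exists_le_brokenCDF hγ hx i) w

/-- The magician opens each box with probability `γ`. -/
theorem sum_openProb_brokenCDF (hγ : γ ∈ Set.Icc (0 : ℝ) 1) (hx : ∀ i, x i ∈ Set.Icc (0 : ℝ) 1)
    (i : ℕ) : ∑ w ∈ Finset.range (i + 1), openProb γ (brokenCDF γ x i) w *
      (brokenCDF γ x i w - cdfPred (brokenCDF γ x i) w) = γ := by
  simp only [openProb_brokenCDF_mul_sub hγ hx]
  have : ∀ k, ∑ w ∈ Finset.range k,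
      (min γ (brokenCDF γ x i w) - min γ (cdfPred (brokenCDF γ x i) w)) =
        min γ (cdfPred (brokenCDF γ x i) k) := by
    intro k
    induction k with
    | zero => simp [cdfPred, hγ.1]
    | succ k ih => rw [Finset.sum_range_succ, ih, cdfPred]; ring
  rw [this, cdfPred, brokenCDF_eq_one hγ hx le_rfl, min_eq_left hγ.2]

/-- A larger γ breaks stochastically more wands. Hence parameters below an admissible one are
admissible. -/
theorem brokenCDF_antitone_param {γ' : ℝ} (hγ : γ ∈ Set.Icc (0 : ℝ) 1)
    (hγ' : γ' ∈ Set.Icc (0 : ℝ) 1) (hx : ∀ i, x i ∈ Set.Icc (0 : ℝ) 1) (h : γ' ≤ γ) (i w : ℕ) :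
    brokenCDF γ x i w ≤ brokenCDF γ' x i w := by
  induction i generalizing w with
  | zero => exact le_rfl
  | succ i ih =>
    rw [brokenCDF_succ hγ hx, brokenCDF_succ hγ' hx]
    refine sub_mul_min_sub_min_le (hx i) h (ih w) ?_
      (cdfPred_le (brokenCDF_nonneg hγ hx i) (brokenCDF_mono hγ hx i) w)
    cases w with
    | zero => exact le_rfl
    | succ w => exact ih w

/-- Makes admissibility a closed condition on γ, so that the supremum γ_k is itself admissible. -/
theorem continuousOn_brokenCDF (hx : ∀ i, x i ∈ Set.Icc (0 : ℝ) 1) (i w : ℕ) :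
    ContinuousOn (fun γ => brokenCDF γ x i w) (Set.Icc 0 1) := by
  induction i generalizing w with
  | zero => exact continuousOn_const
  | succ i ih =>
    have h : ContinuousOn (fun γ => cdfPred (brokenCDF γ x i) w) (Set.Icc 0 1) := by
      cases w with
      | zero => exact continuousOn_const
      | succ w => exact ih w
    refine ContinuousOn.congr ((ih w).sub ((continuousOn_const (c := x i)).mul
      ((continuousOn_id.inf (ih w)).sub (continuousOn_id.inf h)))) fun γ hγ => ?_
    exact brokenCDF_succ hγ hx i w

theorem bddAbove_magicianParam (k : ℕ) :
    BddAbove {γ : ℝ | γ ∈ Set.Icc 0 1 ∧ ∀ K : ℕ, k ≤ K → ∀ (N : ℕ) (x : ℕ → ℝ),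
      (∀ i, x i ∈ Set.Icc 0 1) → ∑ i ∈ Finset.range N, x i ≤ K →
        ∀ i < N, threshold γ (brokenCDF γ x i) < K} :=
  ⟨1, fun _ h => h.1.2⟩

theorem magicianParam_le_one (k : ℕ) : magicianParam k ≤ 1 :=
  Real.sSup_le (fun _ h => h.1.2) zero_le_one

theorem mem_Icc_of_le_magicianParam {k : ℕ} (hγ : γ ∈ Set.Icc 0 (magicianParam k)) :
    γ ∈ Set.Icc (0 : ℝ) 1 := ⟨hγ.1, hγ.2.trans (magicianParam_le_one k)⟩

/-- The supremum that defines `magicianParam` is attained, and all smaller parameters are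
admissible as well. -/
theorem threshold_lt_of_le_magicianParam {k : ℕ} (hk : 1 ≤ k)
    (hγ : γ ∈ Set.Icc 0 (magicianParam k)) {K : ℕ} (hK : k ≤ K) {N : ℕ}
    (hx : ∀ i, x i ∈ Set.Icc (0 : ℝ) 1) (hsum : ∑ i ∈ Finset.range N, x i ≤ K) {i : ℕ}
    (hi : i < N) : threshold γ (brokenCDF γ x i) < K := by
  -- Rewriting `< K` as `≤ K - 1` needs K ≥ 1, which comes from `hk`.
  have hlt : ∀ γ ∈ Set.Icc (0 : ℝ) 1, threshold γ (brokenCDF γ x i) < K ↔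
      γ ≤ brokenCDF γ x i (K - 1) := by
    intro γ hγ
    rw [← threshold_le_iff (brokenCDF_mono hγ hx i) (exists_le_brokenCDF hγ hx i)]
    omega
  have hclosed : IsClosed {γ ∈ Set.Icc (0 : ℝ) 1 | γ ≤ brokenCDF γ x i (K - 1)} :=
    isClosed_Icc.isClosed_le continuousOn_id (continuousOn_brokenCDF hx i (K - 1))
  have hmem : magicianParam k ∈ {γ ∈ Set.Icc (0 : ℝ) 1 | γ ≤ brokenCDF γ x i (K - 1)} := by
    refine closure_minimal ?_ hclosed (csSup_mem_closure ⟨0, ?_⟩ (bddAbove_magicianParam k))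
    · exact fun γ h => ⟨h.1, (hlt γ h.1).1 (h.2 K hK N x hx hsum i hi)⟩
    -- The parameter 0 is admissible: its thresholds are all 0.
    · refine ⟨by simp, fun K hK N x hx _ i _ => ?_⟩
      have h0 : (0 : ℝ) ∈ Set.Icc (0 : ℝ) 1 := by simp
      have := (threshold_le_iff (brokenCDF_mono h0 hx i) (exists_le_brokenCDF h0 hx i) 0).2
        (brokenCDF_nonneg h0 hx i 0)
      omega
  have hγ1 := mem_Icc_of_le_magicianParam hγ
  exact (hlt γ hγ1).2 (hγ.2.trans (hmem.2.trans (brokenCDF_antitone_param hmem.1 hγ1 hx hγ.2 _ _)))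

end

/-! ### Runs of the magician -/

section

variable {n : ℕ} {γ : ℝ} {x : Fin n → ℝ}

theorem extendBoxes_mem_Icc (hx : ∀ i, x i ∈ Set.Icc (0 : ℝ) 1) (i : ℕ) :
    extendBoxes x i ∈ Set.Icc (0 : ℝ) 1 := by
  unfold extendBoxes
  split_ifs
  · exact hx _
  · simp

theorem sum_extendBoxes (x : Fin n → ℝ) : ∑ i ∈ Finset.range n, extendBoxes x i = ∑ i, x i := by
  rw [Finset.sum_range]
  exact Finset.sum_congr rfl fun i _ => by simp [extendBoxes]

open Classical in
theorem brokenWands_succ (γ : ℝ) (x : Fin n → ℝ) (coin : Fin n → unitInterval)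
    (brk : Fin n → Prop) (i : Fin n) :
    brokenWands γ x coin brk (i + 1) = brokenWands γ x coin brk i +
      if opensBox γ x coin brk i ∧ brk i then 1 else 0 := by
  rw [brokenWands]
  simp [opensBox]
  congr

theorem brokenWands_succ_le_iff (γ : ℝ) (x : Fin n → ℝ) (coin : Fin n → unitInterval)
    (brk : Fin n → Prop) (i : Fin n) (w : ℕ) :
    brokenWands γ x coin brk (i + 1) ≤ w ↔ brokenWands γ x coin brk i ≤ w ∧
      ¬(brokenWands γ x coin brk i = w ∧ opensBox γ x coin brk i ∧ brk i) := by
  rw [brokenWands_succ]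
  split_ifs with h
  · simp only [h, and_self, and_true]
    omega
  · simp [h]

open Classical in
theorem brokenWands_eq_card (γ : ℝ) (x : Fin n → ℝ) (coin : Fin n → unitInterval)
    (brk : Fin n → Prop) :
    brokenWands γ x coin brk n =
      (Finset.univ.filter fun i => opensBox γ x coin brk i ∧ brk i).card := by
  have key : ∀ k, k ≤ n → brokenWands γ x coin brk k =
      ∑ i ∈ Finset.range k, if h : i < n then
        if opensBox γ x coin brk ⟨i, h⟩ ∧ brk ⟨i, h⟩ then 1 else 0 else 0 := by
    intro k
    induction k with
    | zero => intro _; simp [brokenWands]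
    | succ k ih =>
      intro hk
      have := brokenWands_succ γ x coin brk ⟨k, hk⟩
      rw [show brokenWands γ x coin brk (k + 1) = _ from this, Finset.sum_range_succ, ih (by omega), dif_pos (show k < n by omega)]
  rw [key n le_rfl, Finset.sum_range, Finset.card_filter]
  simp

theorem brokenWands_le (γ : ℝ) (x : Fin n → ℝ) (coin : Fin n → unitInterval)
    (brk : Fin n → Prop) (i : ℕ) : brokenWands γ x coin brk i ≤ i := by
  induction i with
  | zero => exact le_rfl
  | succ i ih =>
    rw [brokenWands]
    split_ifs <;> omega

/-- The source of all independence: the count before a box is determined by earlier coins and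
outcomes. -/
theorem brokenWands_congr {coin coin' : Fin n → unitInterval} {brk brk' : Fin n → Prop} {i : ℕ}
    (h : ∀ l : Fin n, l < i → coin l = coin' l ∧ (brk l ↔ brk' l)) :
    brokenWands γ x coin brk i = brokenWands γ x coin' brk' i := by
  classical
  induction i with
  | zero => rfl
  | succ i ih =>
    rw [brokenWands, brokenWands, ih fun l hl => h l (by omega)]
    refine congrArg (_ + ·) (if_congr (exists_congr fun hi => ?_) rfl rfl)
    obtain ⟨h1, h2⟩ := h ⟨i, hi⟩ (Nat.lt_succ_self i)
    rw [h1, h2]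

/-- The magician never breaks more wands than the thresholds allow. -/
theorem brokenWands_le_of_threshold_lt {K : ℕ} (hK : ∀ i < n,
      threshold γ (brokenCDF γ (extendBoxes x) i) < K) (coin : Fin n → unitInterval)
    (brk : Fin n → Prop) {i : ℕ} (hi : i ≤ n) : brokenWands γ x coin brk i ≤ K := by
  induction i with
  | zero => simp [brokenWands]
  | succ i ih =>
    rw [brokenWands]
    split_ifs with h
    · obtain ⟨h1, h2, -⟩ := h
      have h3 : brokenWands γ x coin brk i ≤ threshold γ (brokenCDF γ (extendBoxes x) i) := by
        -- Past the threshold the opening probability is 0, and no coin is strictly below 0.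
        by_contra! h4
        rw [openProb, if_neg (by omega), if_neg (by omega)] at h2
        exact absurd h2 (not_lt.2 (coin _).2.1)
      have := hK i h1
      omega
    · exact ih (by omega)

end

/-! ### Product measures -/

section

variable {ι : Type*} {X : ι → Type*} [∀ i, MeasurableSpace (X i)]

theorem measurable_update_prod [DecidableEq ι] (i : ι) :
    Measurable fun p : X i × (∀ l, X l) => Function.update p.2 i p.1 := by
  refine measurable_pi_lambda _ fun l => ?_
  by_cases h : l = i
  · subst h
    simpa using measurable_fst
  · simp only [Function.update_of_ne h]
    fun_prop

variable [Fintype ι]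

/-- A product of probability measures is invariant under resampling one coordinate. -/
theorem measurePreserving_update [DecidableEq ι] (μ : ∀ l, Measure (X l)) [∀ l, IsProbabilityMeasure (μ l)]
    (i : ι) : MeasurePreserving (fun p : X i × (∀ l, X l) => Function.update p.2 i p.1)
      ((μ i).prod (Measure.pi μ)) (Measure.pi μ) := by
  refine ⟨measurable_update_prod i, (Measure.pi_eq fun s hs => ?_).symm⟩
  rw [Measure.map_apply (measurable_update_prod i) (MeasurableSet.univ_pi hs)]
  have : (fun p : X i × (∀ l, X l) => Function.update p.2 i p.1) ⁻¹' Set.univ.pi s =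
      s i ×ˢ Set.univ.pi (Function.update s i Set.univ) := by
    ext ⟨z, y⟩
    simp only [Set.mem_preimage, Set.mem_univ_pi, Set.mem_prod]
    constructor
    · refine fun h => ⟨by simpa using h i, fun l => ?_⟩
      by_cases hl : l = i
      · subst hl; simp
      · simpa [hl] using h l
    · rintro ⟨h1, h2⟩ l
      by_cases hl : l = i
      · subst hl; simpa using h1
      · simpa [hl] using h2 l
  rw [this, Measure.prod_prod, Measure.pi_pi, ← Finset.mul_prod_erase _ _ (Finset.mem_univ i),
    ← Finset.mul_prod_erase _ (fun l => μ l (s l)) (Finset.mem_univ i)]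
  simp only [Function.update_self, measure_univ, one_mul]
  congr 1
  refine Finset.prod_congr rfl fun l hl => ?_
  rw [Function.update_of_ne (Finset.ne_of_mem_erase hl)]

theorem lintegral_pi_eq_lintegral_update [DecidableEq ι] (μ : ∀ l, Measure (X l))
    [∀ l, IsProbabilityMeasure (μ l)] (i : ι) {f : (∀ l, X l) → ℝ≥0∞} (hf : Measurable f) :
    ∫⁻ x, f x ∂Measure.pi μ = ∫⁻ z, ∫⁻ x, f (Function.update x i z) ∂Measure.pi μ ∂μ i := by
  rw [← (measurePreserving_update μ i).lintegral_comp hf, lintegral_prod]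
  exact (hf.comp (measurable_update_prod i)).aemeasurable

theorem lintegral_pi_prod {μ : ∀ l, Measure (X l)} [∀ l, IsProbabilityMeasure (μ l)]
    {f : ∀ l, X l → ℝ≥0∞} (hf : ∀ l, Measurable (f l)) :
    ∫⁻ x, ∏ l, f l (x l) ∂Measure.pi μ = ∏ l, ∫⁻ z, f l z ∂μ l := by
  refine (lintegral_prod_eq_prod_lintegral_of_indepFun Finset.univ
    (fun l (x : ∀ l, X l) => f l (x l)) (iIndepFun_pi fun l => (hf l).aemeasurable)
    fun l => (hf l).comp (measurable_pi_apply l)).trans ?_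
  exact Finset.prod_congr rfl fun l _ => (measurePreserving_eval μ l).lintegral_comp (hf l)

variable {Y : ι → Type*} [∀ i, MeasurableSpace (Y i)]

theorem measurable_pi_kernel (κ : ∀ l, Kernel (X l) (Y l)) [∀ l, IsMarkovKernel (κ l)] :
    Measurable fun x : ∀ l, X l => Measure.pi fun l => κ l (x l) := by
  refine Measurable.measure_of_isPiSystem_of_isProbabilityMeasure
    generateFrom_pi.symm isPiSystem_pi ?_
  rintro _ ⟨s, hs, rfl⟩
  simp only [Measure.pi_pi]
  exact Finset.measurable_fun_prod _ fun i _ =>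
    ((κ i).measurable_coe (hs i (Set.mem_univ i))).comp (measurable_pi_apply i)

/-- Averaging independent types out of independent runs leaves the outcomes independent, each with
its own mixture as law. -/
theorem pi_bind_pi (μ : ∀ l, Measure (X l)) [∀ l, IsProbabilityMeasure (μ l)]
    (κ : ∀ l, Kernel (X l) (Y l)) [∀ l, IsMarkovKernel (κ l)] :
    (Measure.pi μ).bind (fun x => Measure.pi fun l => κ l (x l)) =
      Measure.pi fun l => (μ l).bind (κ l) := by
  refine (Measure.pi_eq fun s hs => ?_).symm
  rw [Measure.bind_apply (MeasurableSet.univ_pi hs) (measurable_pi_kernel κ).aemeasurable]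
  simp only [Measure.pi_pi]
  rw [lintegral_pi_prod fun l => (κ l).measurable_coe (hs l)]
  exact Finset.prod_congr rfl fun l _ =>
    (Measure.bind_apply (hs l) (κ l).measurable.aemeasurable).symm

end

/-! ### The law of a run of a magician -/

section

variable {n m : ℕ}

theorem volume_coin_lt {s : ℝ} (hs : s ∈ Set.Icc (0 : ℝ) 1) (j : Fin m) :
    volume {u : Fin m → unitInterval | (u j : ℝ) < s} = ENNReal.ofReal s := by
  have := (measurePreserving_eval (fun _ : Fin m => (volume : Measure unitInterval)) j).measure_preimage
    (measurableSet_Iio (a := (⟨s, hs⟩ : unitInterval))).nullMeasurableSet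
  rw [unitInterval.volume_Iio] at this
  exact this

/-- The law of tentative outcomes, drawn independently from `μ`, together with the coins. -/
noncomputable def runLaw (μ : Fin n → Measure (Outcome m)) :
    Measure ((Fin n → Outcome m) × (Fin n → Fin m → unitInterval)) :=
  (Measure.pi μ).prod volume

variable (μ : Fin n → Measure (Outcome m)) [∀ l, IsProbabilityMeasure (μ l)]

instance : IsProbabilityMeasure (runLaw μ) := by unfold runLaw; infer_instance

/-- Redrawing both the outcome and the coins of one buyer does not change the law. This exposes her
coordinates as an outer integral, over which events about other buyers are constant. -/
theorem lintegral_runLaw_update (a : Fin n)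
    {H : (Fin n → Outcome m) × (Fin n → Fin m → unitInterval) → ℝ≥0∞} (hH : Measurable H) :
    ∫⁻ ω, H ω ∂runLaw μ = ∫⁻ z, ∫⁻ u, ∫⁻ ω,
      H (Function.update ω.1 a z, Function.update ω.2 a u) ∂runLaw μ ∂volume ∂μ a := by
  have hupd1 := measurable_update_prod (X := fun _ : Fin n => Outcome m) a
  have hupd2 := measurable_update_prod (X := fun _ : Fin n => Fin m → unitInterval) a
  unfold runLaw
  rw [lintegral_prod _ hH.aemeasurable,
    lintegral_pi_eq_lintegral_update μ a hH.lintegral_prod_right']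
  refine lintegral_congr fun z => ?_
  have hz : Measurable fun y : Fin n → Outcome m => Function.update y a z :=
    hupd1.comp measurable_prodMk_left
  calc ∫⁻ y, ∫⁻ b, H (Function.update y a z, b) ∂volume ∂Measure.pi μ
      = ∫⁻ y, ∫⁻ u, ∫⁻ b, H (Function.update y a z, Function.update b a u)
          ∂volume ∂volume ∂Measure.pi μ := by
        refine lintegral_congr fun y => ?_
        exact lintegral_pi_eq_lintegral_update (fun _ => volume) a
          (hH.comp measurable_prodMk_left)
    _ = _ := by
        rw [lintegral_lintegral_swap]
        · refine lintegral_congr fun u => ?_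
          have hu : Measurable fun b : Fin n → Fin m → unitInterval => Function.update b a u :=
            hupd2.comp measurable_prodMk_left
          rw [lintegral_prod]
          exact (hH.comp ((hz.comp measurable_fst).prodMk (hu.comp measurable_snd))).aemeasurable
        · refine Measurable.aemeasurable ?_
          refine Measurable.lintegral_prod_right' (f := fun p :
            ((Fin n → Outcome m) × (Fin m → unitInterval)) × (Fin n → Fin m → unitInterval) =>
            H (Function.update p.1.1 a z, Function.update p.2 a p.1.2)) ?_
          exact hH.comp ((hz.comp (measurable_fst.comp measurable_fst)).prodMk
            (hupd2.comp ((measurable_snd.comp measurable_fst).prodMk measurable_snd)))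

/-- An event that does not depend on coordinate `a` is independent of the coins and of the outcome
of buyer `a`. -/
theorem lintegral_runLaw_of_update_mem_iff (a : Fin n) (j : Fin m) {s : ℝ}
    (hs : s ∈ Set.Icc (0 : ℝ) 1)
    {A : Set ((Fin n → Outcome m) × (Fin n → Fin m → unitInterval))} (hA : MeasurableSet A)
    (hAu : ∀ ω z u, (Function.update ω.1 a z, Function.update ω.2 a u) ∈ A ↔ ω ∈ A)
    {g : Outcome m → ℝ≥0∞} (hg : Measurable g) :
    ∫⁻ ω, A.indicator 1 ω * {c | (c j : ℝ) < s}.indicator 1 (ω.2 a) * g (ω.1 a) ∂runLaw μ =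
      runLaw μ A * ENNReal.ofReal s * ∫⁻ o, g o ∂μ a := by
  have hc : MeasurableSet {c : Fin m → unitInterval | (c j : ℝ) < s} :=
    measurableSet_lt (by fun_prop) measurable_const
  have hi1 : Measurable (A.indicator
      (1 : (Fin n → Outcome m) × (Fin n → Fin m → unitInterval) → ℝ≥0∞)) := measurable_one.indicator hA
  have hi2 : Measurable ({c : Fin m → unitInterval | (c j : ℝ) < s}.indicator
      (1 : (Fin m → unitInterval) → ℝ≥0∞)) :=
    measurable_one.indicator hc
  rw [lintegral_runLaw_update μ a (by fun_prop)]
  have h1 : ∀ ω z u, A.indicator (1 : _ × _ → ℝ≥0∞)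
      (Function.update ω.1 a z, Function.update ω.2 a u) = A.indicator 1 ω := by
    intro ω z u
    by_cases h : ω ∈ A
    · rw [Set.indicator_of_mem h, Set.indicator_of_mem ((hAu ω z u).2 h)]; rfl
    · rw [Set.indicator_of_notMem h, Set.indicator_of_notMem (mt (hAu ω z u).1 h)]
  simp only [h1, Function.update_self]
  have h2 : ∀ z u, ∫⁻ ω, A.indicator 1 ω *
      {c : Fin m → unitInterval | (c j : ℝ) < s}.indicator 1 u * g z ∂runLaw μ =
      runLaw μ A * ({c : Fin m → unitInterval | (c j : ℝ) < s}.indicator 1 u * g z) := by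
    intro z u
    simp only [mul_assoc]
    rw [lintegral_mul_const _ hi1, lintegral_indicator_one hA]
  have h3 : ∀ z, ∫⁻ u, runLaw μ A * ({c : Fin m → unitInterval | (c j : ℝ) < s}.indicator 1 u * g z) =
      runLaw μ A * ENNReal.ofReal s * g z := by
    intro z
    rw [lintegral_const_mul _ (by fun_prop), lintegral_mul_const _ hi2, lintegral_indicator_one hc,
      volume_coin_lt hs, mul_assoc]
  simp only [h2, h3]
  exact lintegral_const_mul _ hg

/-- The number of wands of magician `j` that are broken before buyer `a`. -/
noncomputable def wands (γ : ℝ) (x : Fin n → Fin m → ℝ) (j : Fin m) (a : ℕ)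
    (ω : (Fin n → Outcome m) × (Fin n → Fin m → unitInterval)) : ℕ :=
  brokenWands γ (fun l => x l j) (fun l => ω.2 l j) (fun l => j ∈ (ω.1 l).1) a

variable {γ : ℝ} {x : Fin n → Fin m → ℝ}

theorem measurable_wands (γ : ℝ) (x : Fin n → Fin m → ℝ) (j : Fin m) (a : ℕ) :
    Measurable (wands γ x j a) := measurable_brokenWands γ x j a

theorem wands_update (γ : ℝ) (x : Fin n → Fin m → ℝ) (j : Fin m) (a : Fin n)
    (ω : (Fin n → Outcome m) × (Fin n → Fin m → unitInterval)) (z : Outcome m)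
    (u : Fin m → unitInterval) :
    wands γ x j a (Function.update ω.1 a z, Function.update ω.2 a u) = wands γ x j a ω := by
  refine brokenWands_congr fun l hl => ?_
  have : l ≠ a := fun h => by simp [h] at hl
  simp [this]

theorem lintegral_runLaw_wands_eq (hγ : γ ∈ Set.Icc (0 : ℝ) 1)
    (hx : ∀ i j, x i j ∈ Set.Icc (0 : ℝ) 1) (j : Fin m) (a : Fin n) (w : ℕ)
    {g : Outcome m → ℝ≥0∞} (hg : Measurable g) :
    ∫⁻ ω, {ω | wands γ x j a ω = w}.indicator 1 ω *
      {c | (c j : ℝ) < openProb γ (brokenCDF γ (extendBoxes fun l => x l j) a) w}.indicator 1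
        (ω.2 a) * g (ω.1 a) ∂runLaw μ =
      runLaw μ {ω | wands γ x j a ω = w} *
        ENNReal.ofReal (openProb γ (brokenCDF γ (extendBoxes fun l => x l j) a) w) *
        ∫⁻ o, g o ∂μ a :=
  lintegral_runLaw_of_update_mem_iff μ a j
    (openProb_brokenCDF_mem_Icc hγ (extendBoxes_mem_Icc fun i => hx i j) _ _)
    (measurable_wands γ x j a (measurableSet_singleton w))
    (fun ω z u => by
      rw [Set.mem_preimage, Set.mem_preimage, wands_update]) hg

theorem measureReal_wands_eq {j : Fin m} {a : ℕ}
    (h : ∀ w, (runLaw μ).real {ω | wands γ x j a ω ≤ w} =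
      brokenCDF γ (extendBoxes fun l => x l j) a w) (w : ℕ) :
    (runLaw μ).real {ω | wands γ x j a ω = w} =
      brokenCDF γ (extendBoxes fun l => x l j) a w -
        cdfPred (brokenCDF γ (extendBoxes fun l => x l j) a) w := by
  cases w with
  | zero =>
    rw [cdfPred, ← h]
    simp
  | succ w =>
    rw [cdfPred, ← h, ← h, ← measureReal_sdiff]
    · congr 1
      ext ω
      simp only [Set.mem_ofPred_eq, Set.mem_sdiff]
      omega
    · intro ω hω
      simp only [Set.mem_ofPred_eq] at hω ⊢
      omega
    · exact measurable_wands γ x j a measurableSet_Iic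

/-- `brokenCDF` is the distribution function of the number of broken wands. -/
theorem measureReal_wands_le (hγ : γ ∈ Set.Icc (0 : ℝ) 1)
    (hx : ∀ i j, x i j ∈ Set.Icc (0 : ℝ) 1) (j : Fin m) {a : ℕ} (ha : a ≤ n)
    (hμ : ∀ l : Fin n, l < a → x l j = (μ l).real {o | j ∈ o.1}) (w : ℕ) :
    (runLaw μ).real {ω | wands γ x j a ω ≤ w} =
      brokenCDF γ (extendBoxes fun l => x l j) a w := by
  induction a generalizing w with
  | zero => simp [wands, brokenWands, brokenCDF]
  | succ a ih =>
    have ih' := ih (by omega) fun l hl => hμ l (by omega)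
    set b : Fin n := ⟨a, ha⟩
    have hS : MeasurableSet {o : Outcome m | j ∈ o.1} :=
      measurable_fst (measurableSet_mem_finset j)
    have hxe := extendBoxes_mem_Icc fun i => hx i j
    set p := openProb γ (brokenCDF γ (extendBoxes fun l => x l j) a) w with hp
    have hpI : p ∈ Set.Icc (0 : ℝ) 1 := openProb_brokenCDF_mem_Icc hγ hxe a w
    -- The runs that leave the event of at most w broken wands at this box: exactly w are broken,
    -- the box is opened and its wand breaks.
    set E : Set ((Fin n → Outcome m) × (Fin n → Fin m → unitInterval)) :=
      {ω | wands γ x j a ω = w ∧ (ω.2 b j : ℝ) < p ∧ j ∈ (ω.1 b).1} with hE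
    have hEm : MeasurableSet E := by
      refine MeasurableSet.inter (measurable_wands γ x j a (measurableSet_singleton w))
        (MeasurableSet.inter (measurableSet_lt (f := fun ω : (Fin n → Outcome m) ×
        (Fin n → Fin m → unitInterval) => (ω.2 b j : ℝ)) (by fun_prop) measurable_const) ?_)
      exact (show Measurable fun ω : (Fin n → Outcome m) × (Fin n → Fin m → unitInterval) =>
        ω.1 b by fun_prop) hS
    have hdiff : {ω | wands γ x j (a + 1) ω ≤ w} = {ω | wands γ x j a ω ≤ w} \ E := by
      ext ω
      refine (brokenWands_succ_le_iff γ (fun l => x l j) (fun l => ω.2 l j)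
        (fun l => j ∈ (ω.1 l).1) b w).trans (and_congr_right fun _ => not_congr ?_)
      -- The opening probability is evaluated at the current count, which is w on this event.
      refine and_congr_right fun h => and_congr_left fun _ => ?_
      rw [opensBox, h]
    have hsub : E ⊆ {ω | wands γ x j a ω ≤ w} := fun ω h => h.1.le
    have hmeas : runLaw μ E = runLaw μ {ω | wands γ x j a ω = w} * ENNReal.ofReal p *
        μ b {o | j ∈ o.1} := by
      have := lintegral_runLaw_wands_eq μ hγ hx j b w
        (g := {o : Outcome m | j ∈ o.1}.indicator 1) (measurable_one.indicator hS)
      rw [lintegral_indicator_one hS] at this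
      rw [← lintegral_indicator_one hEm]
      refine Eq.trans (lintegral_congr fun ω => ?_) this
      change E.indicator 1 ω = {ω | wands γ x j a ω = w}.indicator 1 ω *
        {c : Fin m → unitInterval | (c j : ℝ) < p}.indicator 1 (ω.2 b) *
        {o : Outcome m | j ∈ o.1}.indicator 1 (ω.1 b)
      by_cases h1 : wands γ x j a ω = w <;> by_cases h2 : (ω.2 b j : ℝ) < p <;>
        by_cases h3 : j ∈ (ω.1 b).1 <;> simp [Set.indicator, hE, h1, h2, h3]
    have hreal : (runLaw μ).real E = (runLaw μ).real {ω | wands γ x j a ω = w} * p *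
        (μ b).real {o | j ∈ o.1} := by
      rw [measureReal_def, hmeas, ENNReal.toReal_mul, ENNReal.toReal_mul,
        ENNReal.toReal_ofReal hpI.1]
      rfl
    rw [hdiff, measureReal_sdiff hsub hEm, ih', hreal, measureReal_wands_eq μ ih' w,
      brokenCDF_succ hγ hxe, ← openProb_brokenCDF_mul_sub hγ hxe,
      ← hμ b (by simp [b]), ← hp]
    rw [show extendBoxes (fun l => x l j) a = x b j by simp [extendBoxes, b, show a < n from ha]]
    ring

open Classical in
/-- Whatever the outcome of buyer `i` is, magician `j` opens her box with probability `γ`. -/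
theorem lintegral_opensBox (hγ : γ ∈ Set.Icc (0 : ℝ) 1)
    (hx : ∀ i j, x i j ∈ Set.Icc (0 : ℝ) 1) (j : Fin m) (i : Fin n)
    (hμ : ∀ l < i, x l j = (μ l).real {o | j ∈ o.1})
    {g : Outcome m → ℝ≥0∞} (hg : Measurable g) :
    ∫⁻ ω, (if opensBox γ (fun l => x l j) (fun l => ω.2 l j) (fun l => j ∈ (ω.1 l).1) i
      then g (ω.1 i) else 0) ∂runLaw μ = ENNReal.ofReal γ * ∫⁻ o, g o ∂μ i := by
  have hxe := extendBoxes_mem_Icc fun i => hx i j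
  set F := brokenCDF γ (extendBoxes fun l => x l j) i with hF
  -- Conditioning on the wand count fixes the opening probability. At most i wands are broken before
  -- box i, so the range is finite.
  have hsplit : ∀ ω : (Fin n → Outcome m) × (Fin n → Fin m → unitInterval),
      (if opensBox γ (fun l => x l j) (fun l => ω.2 l j) (fun l => j ∈ (ω.1 l).1) i
        then g (ω.1 i) else 0) =
      ∑ w ∈ Finset.range ((i : ℕ) + 1), {ω | wands γ x j i ω = w}.indicator 1 ω *
        {c | (c j : ℝ) < openProb γ F w}.indicator 1 (ω.2 i) * g (ω.1 i) := by
    intro ω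
    have hle : wands γ x j i ω ≤ i := brokenWands_le _ _ _ _ _
    rw [Finset.sum_eq_single_of_mem (wands γ x j i ω) (by simp; omega)]
    · have ho : opensBox γ (fun l => x l j) (fun l => ω.2 l j) (fun l => j ∈ (ω.1 l).1) i ↔
        (ω.2 i j : ℝ) < openProb γ F (wands γ x j i ω) := Iff.rfl
      by_cases h : (ω.2 i j : ℝ) < openProb γ F (wands γ x j i ω)
        <;> simp [ho, Set.indicator, h]
    · intro w _ hw
      rw [Set.indicator_of_notMem (by simpa using hw.symm)]
      simp
  simp only [hsplit]
  rw [lintegral_finsetSum]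
  · rw [Finset.sum_congr rfl fun w _ => lintegral_runLaw_wands_eq μ hγ hx j i w hg, ← Finset.sum_mul]
    congr 1
    conv_rhs => rw [← sum_openProb_brokenCDF hγ hxe i]
    rw [ENNReal.ofReal_sum_of_nonneg]
    · refine Finset.sum_congr rfl fun w _ => ?_
      have := measureReal_wands_eq μ (measureReal_wands_le μ hγ hx j i.2.le hμ) w
      rw [← this, ENNReal.ofReal_mul (openProb_brokenCDF_mem_Icc hγ hxe i w).1, mul_comm,
        ofReal_measureReal]
    · intro w _
      exact mul_nonneg (openProb_brokenCDF_mem_Icc hγ hxe i w).1 (sub_nonneg.2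
        (cdfPred_le (brokenCDF_nonneg hγ hxe i) (brokenCDF_mono hγ hxe i) w))
  · intro w _
    have h1 : Measurable ({ω | wands γ x j i ω = w}.indicator
        (1 : (Fin n → Outcome m) × (Fin n → Fin m → unitInterval) → ℝ≥0∞)) :=
      measurable_one.indicator (measurable_wands γ x j i (measurableSet_singleton w))
    have h2 : Measurable ({c : Fin m → unitInterval | (c j : ℝ) < openProb γ F w}.indicator
        (1 : (Fin m → unitInterval) → ℝ≥0∞)) :=
      measurable_one.indicator (measurableSet_lt (by fun_prop) measurable_const)
    fun_prop

end

section

variable {n m : ℕ} {T : Fin n → Type*} [∀ i, MeasurableSpace (T i)]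
  (D : ∀ i, Measure (T i)) [∀ i, IsProbabilityMeasure (D i)]

/-! ### Induced single buyer mechanisms -/

theorem lintegral_induced (i : Fin n) (M : MultiMechanism T m) (t : T i) {f : Outcome m → ℝ≥0∞}
    (hf : Measurable f) :
    ∫⁻ o, f o ∂(induced D i M).kernel t =
      ∫⁻ t', ∫⁻ o, f (o i) ∂M.kernel (Function.update t' i t) ∂Measure.pi D := by
  have hf' : Measurable fun o : Fin n → Outcome m => f (o i) := hf.comp (measurable_pi_apply i)
  simp only [induced]
  rw [Kernel.lintegral_map _ (measurable_pi_apply i) _ hf, Kernel.lintegral_comp _ _ _ hf',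
    Kernel.lintegral_id_prod hf'.lintegral_kernel]
  simp only [Kernel.lintegral_comap, Kernel.const_apply]

theorem lintegral_lintegral_induced (i : Fin n) (M : MultiMechanism T m)
    {f : T i → Outcome m → ℝ≥0∞} (hf : Measurable fun z : T i × Outcome m => f z.1 z.2) :
    ∫⁻ t, ∫⁻ o, f t o ∂(induced D i M).kernel t ∂D i =
      ∫⁻ t, ∫⁻ o, f (t i) (o i) ∂M.kernel t ∂Measure.pi D := by
  rw [lintegral_pi_eq_lintegral_update D i]
  · refine lintegral_congr fun t => ?_
    rw [lintegral_induced D i M t (f := f t) (hf.comp measurable_prodMk_left)]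
    simp
  · refine Measurable.lintegral_kernel_prod_right (f := fun (t : ∀ l, T l)
      (o : Fin n → Outcome m) => f (t i) (o i)) ?_
    exact hf.comp (by fun_prop : Measurable fun z : (∀ l, T l) × (Fin n → Outcome m) =>
      (z.1 i, z.2 i))

/-- A separable objective sees a mechanism only through what each buyer perceives, because
resampling her type leaves the prior unchanged. -/
theorem expectedObjective_eq_sum {obj : ∀ i, T i → Finset (Fin m) → ℝ≥0 → ℝ≥0}
    (hobj : ∀ i, Measurable fun z : T i × Outcome m => obj i z.1 z.2.1 z.2.2)
    (M : MultiMechanism T m) :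
    expectedObjective D obj M = ∑ i, singleObjective (D i) (obj i) (induced D i M) := by
  have hz : ∀ i, Measurable fun z : (∀ l, T l) × (Fin n → Outcome m) =>
      (obj i (z.1 i) (z.2 i).1 (z.2 i).2 : ℝ≥0∞) := fun i =>
    ((hobj i).comp (by fun_prop : Measurable fun z : (∀ l, T l) × (Fin n → Outcome m) =>
      (z.1 i, z.2 i))).coe_nnreal_ennreal
  simp only [expectedObjective, singleObjective, ENNReal.ofNNReal_finsetSum]
  have h1 : ∀ t : ∀ l, T l, ∫⁻ o, ∑ i, (obj i (t i) (o i).1 (o i).2 : ℝ≥0∞) ∂M.kernel t =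
      ∑ i, ∫⁻ o, (obj i (t i) (o i).1 (o i).2 : ℝ≥0∞) ∂M.kernel t := fun t =>
    lintegral_finsetSum _ fun i _ => (hz i).comp measurable_prodMk_left
  simp only [h1]
  rw [lintegral_finsetSum _ fun i _ => Measurable.lintegral_kernel_prod_right
    (f := fun (t : ∀ l, T l) (o : Fin n → Outcome m) => (obj i (t i) (o i).1 (o i).2 : ℝ≥0∞))
    (hz i)]
  refine Finset.sum_congr rfl fun i _ => ?_
  rw [lintegral_lintegral_induced D i M (f := fun t o => (obj i t o.1 o.2 : ℝ≥0∞))]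
  exact (hobj i).coe_nnreal_ennreal

theorem measurableSet_mem_outcome (j : Fin m) : MeasurableSet {o : Outcome m | j ∈ o.1} :=
  measurable_fst (measurableSet_mem_finset j)

theorem lintegral_kernel_mem_le_one {Θ : Type*} [MeasurableSpace Θ] (μ : Measure Θ)
    [IsProbabilityMeasure μ] (N : SingleMechanism Θ m) (j : Fin m) :
    ∫⁻ t, N.kernel t {o | j ∈ o.1} ∂μ ≤ 1 :=
  (lintegral_mono fun _ => prob_le_one).trans (by simp)

theorem exAnte_mem_Icc {Θ : Type*} [MeasurableSpace Θ] (μ : Measure Θ)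
    [IsProbabilityMeasure μ] (N : SingleMechanism Θ m) (j : Fin m) :
    exAnte μ N j ∈ Set.Icc (0 : ℝ) 1 :=
  ⟨ENNReal.toReal_nonneg, ENNReal.toReal_le_of_le_ofReal zero_le_one
    (by simpa using lintegral_kernel_mem_le_one μ N j)⟩

/-- Integrating the pointwise supply bound makes the ex ante rule of a feasible mechanism a feasible
point of the benchmark program. -/
theorem sum_exAnte_induced_le {units : Fin m → ℕ} {M : MultiMechanism T m}
    (hM : MeetsSupply units M) (j : Fin m) :
    ∑ i, exAnte (D i) (induced D i M) j ≤ units j := by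
  have hS := measurableSet_mem_outcome j
  have h1 : ∀ i, ∫⁻ t, (induced D i M).kernel t {o | j ∈ o.1} ∂D i =
      ∫⁻ t, ∫⁻ o, {o : Outcome m | j ∈ o.1}.indicator 1 (o i) ∂M.kernel t ∂Measure.pi D := by
    intro i
    rw [← lintegral_lintegral_induced D i M
      (f := fun _ o => {o : Outcome m | j ∈ o.1}.indicator 1 o)
      ((measurable_one.indicator hS).comp measurable_snd)]
    exact lintegral_congr fun t => (lintegral_indicator_one hS).symm
  have hm : ∀ i, Measurable fun z : (∀ l, T l) × (Fin n → Outcome m) =>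
      {o : Outcome m | j ∈ o.1}.indicator (1 : Outcome m → ℝ≥0∞) (z.2 i) := fun i =>
    (measurable_one.indicator hS).comp (by fun_prop)
  simp only [exAnte]
  rw [← ENNReal.toReal_sum fun i _ =>
    ((lintegral_kernel_mem_le_one (D i) (induced D i M) j).trans_lt ENNReal.one_lt_top).ne]
  refine ENNReal.toReal_le_of_le_ofReal (Nat.cast_nonneg _) ?_
  simp only [h1]
  rw [← lintegral_finsetSum _ fun i _ => Measurable.lintegral_kernel_prod_right
    (f := fun (t : ∀ l, T l) (o : Fin n → Outcome m) =>
      {o : Outcome m | j ∈ o.1}.indicator (1 : Outcome m → ℝ≥0∞) (o i)) (hm i)]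
  calc _ ≤ ∫⁻ _ : ∀ l, T l, (units j : ℝ≥0∞) ∂Measure.pi D := by
        refine lintegral_mono fun t => ?_
        rw [← lintegral_finsetSum (f := fun i (o : Fin n → Outcome m) =>
          {o : Outcome m | j ∈ o.1}.indicator (1 : Outcome m → ℝ≥0∞) (o i)) _
          fun i _ => (hm i).comp (measurable_prodMk_left (x := t))]
        calc _ ≤ ∫⁻ _ : Fin n → Outcome m, (units j : ℝ≥0∞) ∂M.kernel t := by
              refine lintegral_mono_ae ?_
              filter_upwards [hM t] with o ho
              have := ho j
              rw [Finset.card_filter] at this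
              have h2 : ∑ i, {o : Outcome m | j ∈ o.1}.indicator (1 : Outcome m → ℝ≥0∞) (o i) =
                  ((∑ i, if j ∈ (o i).1 then 1 else 0 : ℕ) : ℝ≥0∞) := by
                push_cast
                exact Finset.sum_congr rfl fun i _ => by simp [Set.indicator_apply]
              rw [h2]
              exact_mod_cast this
          _ = _ := by simp
    _ = _ := by simp

/-! ### Post-rounding as a buyer perceives it -/

/-- The laws of the tentative outcomes of all buyers, when buyer `i` reports `t` and the types of
the other buyers are drawn from the prior. -/
noncomputable def tentativeLaw (N : ∀ i, SingleMechanism (T i) m) (i : Fin n) (t : T i)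
    (l : Fin n) : Measure (Outcome m) :=
  if l = i then (N i).kernel t else (D l).bind (N l).kernel

/-- The family of mechanisms `N`, with the report of buyer `i` fixed to `t`. -/
noncomputable def fixReport (N : ∀ i, SingleMechanism (T i) m) (i : Fin n) (t : T i) (l : Fin n) :
    Kernel (T l) (Outcome m) :=
  if l = i then Kernel.const _ ((N i).kernel t) else (N l).kernel

variable (N : ∀ i, SingleMechanism (T i) m) (i : Fin n) (t : T i)

instance (l : Fin n) : IsMarkovKernel (fixReport N i t l) := by
  unfold fixReport
  split_ifs <;> infer_instance

theorem bind_fixReport (l : Fin n) : (D l).bind (fixReport N i t l) = tentativeLaw D N i t l := by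
  unfold fixReport tentativeLaw
  split_ifs
  · ext s hs
    rw [Measure.bind_apply hs (Kernel.aemeasurable _)]
    simp
  · rfl

instance (l : Fin n) : IsProbabilityMeasure (tentativeLaw D N i t l) := by
  rw [← bind_fixReport]
  infer_instance

omit [∀ i, IsProbabilityMeasure (D i)] in
theorem tentativeLaw_self : tentativeLaw D N i t i = (N i).kernel t := if_pos rfl

omit [∀ i, IsProbabilityMeasure (D i)] in
-- The written probabilities are exact for everyone but buyer i, whose report is fixed; her own box
-- does not matter for the wand counts before it.
theorem measureReal_tentativeLaw {l : Fin n} (h : l ≠ i) (j : Fin m) :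
    (tentativeLaw D N i t l).real {o | j ∈ o.1} = exAnte (D l) (N l) j := by
  rw [tentativeLaw, if_neg h, measureReal_def, exAnte,
    Measure.bind_apply (measurableSet_mem_outcome j) (Kernel.aemeasurable _)]

theorem runAll_kernel_update (t' : ∀ l, T l) :
    (runAll N).kernel (Function.update t' i t) = Measure.pi fun l => fixReport N i t l (t' l) := by
  change Measure.pi (fun l => (N l).kernel (Function.update t' i t l)) = _
  congr 1
  ext1 l
  by_cases h : l = i
  · subst h
    simp [fixReport]
  · simp [fixReport, h]

/-- Reduces what buyer i perceives to independent tentative outcomes with uniform coins, the setting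
of the magician lemmas. -/
theorem lintegral_induced_postRounding (γ : ℝ) {f : Outcome m → ℝ≥0∞} (hf : Measurable f) :
    ∫⁻ o, f o ∂(induced D i (postRounding D γ N)).kernel t =
      ∫⁻ ω, f (deallocate γ (fun i j => exAnte (D i) (N i) j) ω i)
        ∂runLaw (tentativeLaw D N i t) := by
  set x : Fin n → Fin m → ℝ := fun i j => exAnte (D i) (N i) j
  have hd : Measurable fun ω => f (deallocate γ x ω i) :=
    hf.comp ((measurable_pi_apply i).comp (measurable_deallocate γ x))
  rw [lintegral_induced D i _ t hf]
  have h1 : ∀ t', ∫⁻ o, f (o i) ∂(postRounding D γ N).kernel (Function.update t' i t) =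
      ∫⁻ y, ∫⁻ b, f (deallocate γ x (y, b) i) ∂volume
        ∂Measure.pi fun l => fixReport N i t l (t' l) := by
    intro t'
    simp only [postRounding]
    rw [Kernel.lintegral_map _ (measurable_deallocate γ _) _
      (g' := fun o : Fin n → Outcome m => f (o i)) (hf.comp (measurable_pi_apply i)),
      Kernel.lintegral_prod _ _ _ hd, runAll_kernel_update]
    rfl
  simp only [h1]
  rw [runLaw, lintegral_prod _ hd.aemeasurable]
  have h2 : Measure.pi (tentativeLaw D N i t) =
      (Measure.pi D).bind fun t' => Measure.pi fun l => fixReport N i t l (t' l) := by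
    rw [pi_bind_pi]
    simp only [bind_fixReport]
  rw [h2, Measure.lintegral_bind (measurable_pi_kernel _).aemeasurable
    hd.lintegral_prod_right'.aemeasurable]

theorem lintegral_runLaw_tentative {g : Outcome m → ℝ≥0∞} (hg : Measurable g) :
    ∫⁻ ω, g (ω.1 i) ∂runLaw (tentativeLaw D N i t) = ∫⁻ o, g o ∂(N i).kernel t := by
  have h := ((measurePreserving_eval (tentativeLaw D N i t) i).comp
    (measurePreserving_fst (μ := Measure.pi (tentativeLaw D N i t))
      (ν := (volume : Measure (Fin n → Fin m → unitInterval))))).lintegral_comp hg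
  rw [tentativeLaw_self] at h
  exact h

theorem ae_runLaw_tentative {p : Outcome m → Prop} (hp : ∀ᵐ o ∂(N i).kernel t, p o) :
    ∀ᵐ ω ∂runLaw (tentativeLaw D N i t), p (ω.1 i) := by
  rw [← tentativeLaw_self D N i t] at hp
  exact ((measurePreserving_eval (tentativeLaw D N i t) i).comp
    (measurePreserving_fst (μ := Measure.pi (tentativeLaw D N i t))
      (ν := (volume : Measure (Fin n → Fin m → unitInterval))))).quasiMeasurePreserving.ae hp

theorem deallocate_subset (γ : ℝ) (x : Fin n → Fin m → ℝ)
    (ω : (Fin n → Outcome m) × (Fin n → Fin m → unitInterval)) :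
    (deallocate γ x ω i).1 ⊆ (ω.1 i).1 := by
  classical
  unfold deallocate
  exact Finset.filter_subset _ _

/-- If the items of a bundle have weights that add up, then post-rounding retains a `γ` fraction of
the expected weight. -/
theorem lintegral_sum_deallocate {γ : ℝ} (hγ : γ ∈ Set.Icc (0 : ℝ) 1)
    (a : Fin m → Finset (Fin m) → ℝ≥0) :
    ∫⁻ ω, ((∑ j ∈ (deallocate γ (fun i j => exAnte (D i) (N i) j) ω i).1,
        a j (ω.1 i).1 : ℝ≥0) : ℝ≥0∞) ∂runLaw (tentativeLaw D N i t) =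
      ENNReal.ofReal γ * ∫⁻ o, ((∑ j ∈ o.1, a j o.1 : ℝ≥0) : ℝ≥0∞) ∂(N i).kernel t := by
  classical
  set x : Fin n → Fin m → ℝ := fun i j => exAnte (D i) (N i) j
  set g : Fin m → Outcome m → ℝ≥0∞ := fun j o => if j ∈ o.1 then (a j o.1 : ℝ≥0∞) else 0
  have hg : ∀ j, Measurable (g j) := fun j =>
    (measurable_of_finite fun S : Finset (Fin m) => if j ∈ S then (a j S : ℝ≥0∞) else 0).comp
      measurable_fst
  have h1 : ∀ ω : (Fin n → Outcome m) × (Fin n → Fin m → unitInterval),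
      ((∑ j ∈ (deallocate γ x ω i).1, a j (ω.1 i).1 : ℝ≥0) : ℝ≥0∞) =
      ∑ j, if opensBox γ (fun l => x l j) (fun l => ω.2 l j) (fun l => j ∈ (ω.1 l).1) i
        then g j (ω.1 i) else 0 := by
    intro ω
    rw [deallocate, Finset.sum_filter, ENNReal.ofNNReal_finsetSum, ← Finset.sum_filter_add_sum_filter_not
      Finset.univ (fun j => j ∈ (ω.1 i).1)]
    rw [Finset.sum_eq_zero (s := Finset.univ.filter fun j => ¬ j ∈ (ω.1 i).1), add_zero]
    · refine Finset.sum_congr (by ext; simp) fun j hj => ?_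
      rw [apply_ite ENNReal.ofNNReal]
      simp [g, (Finset.mem_filter.1 hj).2]
    · intro j hj
      simp only [Finset.mem_filter, Finset.mem_univ, true_and] at hj
      simp [g, hj]
  have h2 : ∀ o : Outcome m, ((∑ j ∈ o.1, a j o.1 : ℝ≥0) : ℝ≥0∞) = ∑ j, g j o := by
    intro o
    rw [ENNReal.ofNNReal_finsetSum, ← Finset.sum_filter]
    exact Finset.sum_congr (by ext; simp) fun _ _ => rfl
  simp only [h1, h2]
  have hopen : ∀ j, MeasurableSet {ω : (Fin n → Outcome m) × (Fin n → Fin m → unitInterval) |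
      opensBox γ (fun l => x l j) (fun l => ω.2 l j) (fun l => j ∈ (ω.1 l).1) i} := fun j =>
    measurableSet_lt (by fun_prop)
      ((measurable_from_nat (f := openProb γ _)).comp (measurable_brokenWands γ x j i))
  have hterm : ∀ j, Measurable fun ω : (Fin n → Outcome m) × (Fin n → Fin m → unitInterval) =>
      if opensBox γ (fun l => x l j) (fun l => ω.2 l j) (fun l => j ∈ (ω.1 l).1) i
        then g j (ω.1 i) else 0 := fun j =>
    Measurable.ite (hopen j) ((hg j).comp (by fun_prop)) measurable_const
  rw [lintegral_finsetSum _ fun j _ => hterm j, lintegral_finsetSum _ fun j _ => hg j,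
    Finset.mul_sum]
  refine Finset.sum_congr rfl fun j _ => ?_
  -- Only boxes before that of buyer i must carry exact probabilities, and these belong to other
  -- buyers.
  rw [lintegral_opensBox (tentativeLaw D N i t) hγ (fun l j => exAnte_mem_Icc (D l) (N l) j) j i
    (fun l hl => (measureReal_tentativeLaw D N i t hl.ne j).symm) (hg j), tentativeLaw_self]

theorem lintegral_payment_induced_postRounding (γ : ℝ) :
    ∫⁻ o, (o.2 : ℝ≥0∞) ∂(induced D i (postRounding D γ N)).kernel t =
      ENNReal.ofReal γ * ∫⁻ o, (o.2 : ℝ≥0∞) ∂(N i).kernel t := by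
  rw [lintegral_induced_postRounding D N i t γ (by fun_prop),
    ← lintegral_const_mul _ (by fun_prop),
    ← lintegral_runLaw_tentative D N i t (g := fun o => ENNReal.ofReal γ * (o.2 : ℝ≥0∞))
      (by fun_prop)]
  refine lintegral_congr fun ω => ?_
  rw [deallocate, ENNReal.coe_mul]
  rfl

/-! ### Incentive compatibility of post-rounding -/

/-- Weights are nonnegative, so an independent set is its own heaviest independent subset. -/
theorem IsWeightedRank.eq_sum {M : Matroid (Fin m)} {w : Fin m → ℝ≥0}
    {v : Finset (Fin m) → ℝ≥0} (h : IsWeightedRank M w v) {S : Finset (Fin m)}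
    (hS : M.Indep (S : Set (Fin m))) : v S = ∑ j ∈ S, w j := by
  refine le_antisymm ?_ ((h.2 S).2 ⟨S, subset_rfl, hS, rfl⟩)
  obtain ⟨B, hB, -, hv⟩ := (h.2 S).1
  rw [← hv]
  exact Finset.sum_le_sum_of_subset hB

/-- Post-rounding scales the expected value of a buyer by `γ`. -/
theorem lintegral_value_induced_postRounding {γ : ℝ} (hγ : γ ∈ Set.Icc (0 : ℝ) 1)
    {M : Matroid (Fin m)} {w : Fin m → ℝ≥0} {v : Finset (Fin m) → ℝ≥0}
    (hv : IsWeightedRank M w v)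
    (hN : ∀ᵐ o ∂(N i).kernel t, M.Indep (o.1 : Set (Fin m))) :
    ∫⁻ o, (v o.1 : ℝ≥0∞) ∂(induced D i (postRounding D γ N)).kernel t =
      ENNReal.ofReal γ * ∫⁻ o, (v o.1 : ℝ≥0∞) ∂(N i).kernel t := by
  rw [lintegral_induced_postRounding D N i t γ (f := fun o => (v o.1 : ℝ≥0∞))
    ((measurable_of_finite fun S : Finset (Fin m) => (v S : ℝ≥0∞)).comp measurable_fst)]
  rw [lintegral_congr_ae (g := fun o : Outcome m => ((∑ j ∈ o.1, w j : ℝ≥0) : ℝ≥0∞))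
    (hN.mono fun o ho => by simp only [hv.eq_sum ho]),
    ← lintegral_sum_deallocate D N i t hγ fun j _ => w j]
  refine lintegral_congr_ae ((ae_runLaw_tentative D N i t hN).mono fun ω hω => ?_)
  -- The retained bundle is a subset of an independent one, so its value is additive as well.
  have := hω.subset (Finset.coe_subset.2
    (deallocate_subset i γ (fun i j => exAnte (D i) (N i) j) ω))
  simp only [hv.eq_sum this]

/-- Both sides of each incentive inequality are multiplied by γ. A misreport t' is valued in the
matroid of the true type t, hence independence is needed for all pairs. -/
theorem isIC_induced_postRounding {γ : ℝ} (hγ : γ ∈ Set.Icc (0 : ℝ) 1)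
    {v : T i → Finset (Fin m) → ℝ≥0} {M : T i → Matroid (Fin m)} {w : T i → Fin m → ℝ≥0}
    (hv : ∀ t, IsWeightedRank (M t) (w t) (v t))
    (hN : ∀ t t', ∀ᵐ o ∂(N i).kernel t', (M t).Indep (o.1 : Set (Fin m)))
    (hIC : IsIC v (N i)) : IsIC v (induced D i (postRounding D γ N)) := by
  intro t t'
  rw [lintegral_value_induced_postRounding D N i t hγ (hv t) (hN t t),
    lintegral_value_induced_postRounding D N i t' hγ (hv t) (hN t t'),
    lintegral_payment_induced_postRounding, lintegral_payment_induced_postRounding,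
    ← mul_add, ← mul_add]
  exact mul_le_mul_right (hIC t t') _

/-! ### Retention of the objective -/

/-- Deleting items can only raise the shares of those that remain. -/
theorem sum_subset_le_of_crossMonotonic {f : Finset (Fin m) → ℝ≥0}
    {ξ : Fin m → Finset (Fin m) → ℝ≥0} (hsum : ∀ S, ∑ j ∈ S, ξ j S = f S)
    (hmono : ∀ j S S', ξ j (S ∪ S') ≤ ξ j S) {S S' : Finset (Fin m)} (h : S ⊆ S') :
    ∑ j ∈ S, ξ j S' ≤ f S := by
  rw [← hsum S]
  refine Finset.sum_le_sum fun j _ => ?_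
  have := hmono j S S'
  rwa [Finset.union_eq_right.2 h] at this

/-- Post-rounding retains a `γ` fraction of the expected objective value. -/
theorem mul_lintegral_objective_le {γ : ℝ} (hγ : γ ∈ Set.Icc (0 : ℝ) 1)
    {obj : Finset (Fin m) → ℝ≥0 → ℝ≥0} {c : ℝ≥0} (hobj : ∀ S p, obj S p = obj S 0 + c * p)
    (hshare : HasCostSharing fun S => obj S 0) :
    ENNReal.ofReal γ * ∫⁻ o, (obj o.1 o.2 : ℝ≥0∞) ∂(N i).kernel t ≤
      ∫⁻ o, (obj o.1 o.2 : ℝ≥0∞) ∂(induced D i (postRounding D γ N)).kernel t := by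
  obtain ⟨ξ, hsum, hmono⟩ := hshare
  have hm : Measurable fun o : Outcome m => (obj o.1 0 : ℝ≥0∞) :=
    (measurable_of_finite fun S : Finset (Fin m) => (obj S 0 : ℝ≥0∞)).comp measurable_fst
  have hsplit : ∀ κ : Measure (Outcome m), ∫⁻ o, (obj o.1 o.2 : ℝ≥0∞) ∂κ =
      ∫⁻ o, (obj o.1 0 : ℝ≥0∞) ∂κ + c * ∫⁻ o, (o.2 : ℝ≥0∞) ∂κ := by
    intro κ
    rw [← lintegral_const_mul _ (by fun_prop), ← lintegral_add_left hm]
    refine lintegral_congr fun o => ?_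
    rw [hobj, ENNReal.coe_add, ENNReal.coe_mul]
  -- The payment part scales exactly; only the cost-shared part needs an inequality.
  rw [hsplit, hsplit, lintegral_payment_induced_postRounding, mul_add, mul_left_comm]
  gcongr
  rw [lintegral_induced_postRounding D N i t γ hm]
  have h1 : ∫⁻ o, (obj o.1 0 : ℝ≥0∞) ∂(N i).kernel t =
      ∫⁻ o, ((∑ j ∈ o.1, ξ j o.1 : ℝ≥0) : ℝ≥0∞) ∂(N i).kernel t :=
    lintegral_congr fun o => by rw [hsum]
  rw [h1, ← lintegral_sum_deallocate D N i t hγ ξ]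
  refine lintegral_mono fun ω => ENNReal.coe_le_coe.2 ?_
  exact sum_subset_le_of_crossMonotonic hsum hmono (deallocate_subset i γ _ ω)

/-! ### Supply -/

/-- Turns the supply constraint into a bound on one magician's final wand count. -/
theorem card_deallocate (γ : ℝ) (x : Fin n → Fin m → ℝ)
    (ω : (Fin n → Outcome m) × (Fin n → Fin m → unitInterval)) (j : Fin m) :
    (Finset.univ.filter fun i => j ∈ (deallocate γ x ω i).1).card = wands γ x j n ω := by
  classical
  rw [wands, brokenWands_eq_card]
  congr 1
  ext i
  simp [deallocate, and_comm]

theorem measurableSet_card_le (units : Fin m → ℕ) : MeasurableSet {o : Fin n → Outcome m |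
    ∀ j, (Finset.univ.filter fun i => j ∈ (o i).1).card ≤ units j} := by
  simp only [Set.ofPred_forall, Finset.card_filter]
  refine MeasurableSet.iInter fun j => measurableSet_le ?_ measurable_const
  refine Finset.measurable_fun_sum _ fun i _ => Measurable.ite ?_ measurable_const measurable_const
  exact (measurable_pi_apply i : Measurable fun o : Fin n → Outcome m => o i)
    (measurableSet_mem_outcome j)

theorem meetsSupply_postRounding {units : Fin m → ℕ} {k : ℕ} (hk : 1 ≤ k)
    (hunits : ∀ j, k ≤ units j) {γ : ℝ} (hγ : γ ∈ Set.Icc 0 (magicianParam k))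
    (hsum : ∀ j, ∑ i, exAnte (D i) (N i) j ≤ units j) :
    MeetsSupply units (postRounding D γ N) := by
  intro t
  simp only [postRounding]
  rw [Kernel.map_apply _ (measurable_deallocate γ _),
    ae_map_iff (measurable_deallocate γ _).aemeasurable (measurableSet_card_le units)]
  refine Filter.Eventually.of_forall fun ω j => ?_
  rw [card_deallocate]
  refine brokenWands_le_of_threshold_lt (fun i hi => ?_) _ _ le_rfl
  -- Magician j has K = `units j` wands, and the exact probabilities on its boxes sum to at most K.
  refine threshold_lt_of_le_magicianParam hk hγ (hunits j)
    (extendBoxes_mem_Icc fun i => exAnte_mem_Icc (D i) (N i) j) ?_ hi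
  rw [sum_extendBoxes]
  exact hsum j

end

/-! ### The post-rounding theorem -/

theorem mainTheorem3 {n m : ℕ} {T : Fin n → Type*} [∀ i, MeasurableSpace (T i)]
    -- independent priors of the buyers' types
    (D : ∀ i, Measure (T i)) [∀ i, IsProbabilityMeasure (D i)]
    -- there are `units j ≥ k ≥ 1` units of each item `j`
    (units : Fin m → ℕ) (k : ℕ) (hk : 1 ≤ k) (hunits : ∀ j, k ≤ units j)
    -- valuations, objectives, and the space of feasible mechanisms
    (v : ∀ i, T i → Finset (Fin m) → ℝ≥0)
    (obj : ∀ i, T i → Finset (Fin m) → ℝ≥0 → ℝ≥0)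
    (hobj_meas : ∀ i, Measurable fun z : T i × Outcome m => obj i z.1 z.2.1 z.2.2)
    (C : Set (MultiMechanism T m)) (hC : IsMechanismSpace D units v C)
    -- the approximate single buyer mechanisms with their concave benchmarks
    (α : ℝ≥0) (mech : ∀ i, (Fin m → ℝ) → SingleMechanism (T i) m)
    (R : Fin n → (Fin m → ℝ) → ℝ≥0)
    (hmech : ∀ i, IsApproxSingle α (D i) (obj i) (singleSpace D C i) (mech i) (R i))
    -- the optimal assignment of the benchmark program that is used by the mechanism
    (q : Fin n → Fin m → ℝ) (hq : IsOptimalAssignment units R q)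
    -- the objectives are additive in the payment, and the rest has a cost sharing scheme
    (c : Fin n → ℝ≥0) (hobj : ∀ i t S p, obj i t S p = obj i t S 0 + c i * p)
    (hshare : ∀ i t, HasCostSharing fun S => obj i t S 0)
    -- the valuations are matroid weighted rank functions, and allocated bundles are independent
    (mat : ∀ i, T i → Matroid (Fin m)) (w : ∀ i, T i → Fin m → ℝ≥0)
    (hval : ∀ i t, IsWeightedRank (mat i t) (w i t) (v i t))
    (hindep : ∀ i (t t' : T i), ∀ᵐ o ∂((mech i (q i)).kernel t'), (mat i t).Indep (o.1 : Set (Fin m)))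
    (γ : ℝ) (hγ : γ ∈ Set.Icc 0 (magicianParam k))
    -- the feasible space imposes on the mechanism no single buyer constraint that it violates,
    -- apart from Bayesian incentive compatibility, which is left to be shown
    (hspace : ∀ i, IsIC (v i) (induced D i (postRounding D γ fun l => mech l (q l))) →
      induced D i (postRounding D γ fun l => mech l (q l)) ∈ singleSpace D C i) :
    IsBIC D v (postRounding D γ fun i => mech i (q i)) ∧
    postRounding D γ (fun i => mech i (q i)) ∈ C ∧
    ∀ M ∈ C, ENNReal.ofReal γ * α * expectedObjective D obj M ≤
      expectedObjective D obj (postRounding D γ fun i => mech i (q i)) := by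
  have hγ1 := mem_Icc_of_le_magicianParam hγ
  have hqI : ∀ i, q i ∈ Set.Icc (0 : Fin m → ℝ) 1 := hq.1.1
  have hIC : ∀ i, IsIC (v i) (induced D i (postRounding D γ fun l => mech l (q l))) := by
    intro i
    refine isIC_induced_postRounding D (fun l => mech l (q l)) i hγ1 (hval i) (hindep i) ?_
    obtain ⟨M, hM, hMi⟩ := (hmech i).feasible (q i) (hqI i)
    rw [← hMi]
    exact hC.bic M hM i
  refine ⟨hIC, ?_, fun M hM => ?_⟩
  · refine hC.decomposable _ (meetsSupply_postRounding D _ hk hunits hγ fun j => ?_)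
      fun i => hspace i (hIC i)
    exact (Finset.sum_le_sum fun i _ => (hmech i).exAnte_le (q i) (hqI i) j).trans (hq.1.2 j)
  -- The competitor's own ex ante rule is the feasible point to compare with q.
  · set y : Fin n → Fin m → ℝ := fun i j => exAnte (D i) (induced D i M) j
    have hyI : ∀ i, y i ∈ Set.Icc (0 : Fin m → ℝ) 1 := fun i =>
      ⟨fun j => (exAnte_mem_Icc _ _ j).1, fun j => (exAnte_mem_Icc _ _ j).2⟩
    have hopt := hq.2 y ⟨hyI, sum_exAnte_induced_le D (hC.supply M hM)⟩
    rw [expectedObjective_eq_sum D hobj_meas, expectedObjective_eq_sum D hobj_meas]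
    calc ENNReal.ofReal γ * α * ∑ i, singleObjective (D i) (obj i) (induced D i M)
        ≤ ENNReal.ofReal γ * α * ∑ i, (R i (y i) : ℝ≥0∞) := by
          gcongr with i
          exact (hmech i).upperBound (y i) (hyI i) _ ⟨M, hM, rfl⟩ fun j => le_rfl
      _ ≤ ENNReal.ofReal γ * α * ∑ i, (R i (q i) : ℝ≥0∞) := by
          exact mul_le_mul_right (by exact_mod_cast hopt) _
      _ = ∑ i, ENNReal.ofReal γ * ((α * R i (q i) : ℝ≥0) : ℝ≥0∞) := by
          rw [Finset.mul_sum]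
          exact Finset.sum_congr rfl fun i _ => by rw [ENNReal.coe_mul, mul_assoc]
      _ ≤ _ := by
          refine Finset.sum_le_sum fun i _ => ?_
          refine (mul_le_mul_right ((hmech i).approx (q i) (hqI i)) _).trans ?_
          rw [singleObjective, singleObjective,
            ← lintegral_const_mul' _ _ ENNReal.ofReal_ne_top]
          exact lintegral_mono fun t => mul_lintegral_objective_le D (fun l => mech l (q l)) i t hγ1
            (hobj i t) (hshare i t)
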